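/- **Proposition 2.1.** Let $T>0$ and let $(u,b,P)$, with $u=(u_1,u_2)$ and $b=(b_1,b_2)$, be a classical solution on $\mathbb{R}^2\times[0,T]$ of $$ \begin{cases} \partial_t u+u\cdot\nabla u-\Delta u+\nabla P=b\cdot\nabla b+\partial_2 b,\\ \partial_t b+u\cdot\nabla b=b\cdot\nabla u+\partial_2u,\\ \nabla\cdot u=\nabla\cdot b=0, \end{cases} $$ smooth in the sense that $u$ is of class $C^3$, $b$ of class $C^2$ and $P$ of class $C^1$ jointly in $(x,t)\in\mathbb{R}^2\times[0,T]$, and with $\nabla P(\cdot,\tau)\in L^2(\mathbb{R}^2)$ for all $\tau\in[0,T]$. For $t\in[0,T]$ put $$E_0(t)=\sup_{0\le\tau\le t}\big(\|u(\cdot,\tau)\|_{H^2(\mathbb{R}^2)}^2+\|b(\cdot,\tau)\|_{H^2(\mathbb{R}^2)}^2\big)+\int_0^t\|\nabla u(\cdot,\tau)\|_{H^2(\mathbb{R}^2)}^2\,d\tau,\qquad E_1(t)=\int_0^t\|\partial_2b(\cdot,\tau)\|_{H^1(\mathbb{R}^2)}^2\,d\tau,$$ and assume $E_0(T)<\infty$.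 Let $$\Omega_\pm=u_1\pm b_1,\qquad A_\pm(t)=\int_0^t\int_{\mathbb{R}^2}|\Omega_\pm|^2|\partial_1^2b_2|^2\,dx\,d\tau,$$ $$G_\pm(x_1,x_2,\tau)=|\Omega_\pm(x_1,x_2,\tau)|^2\mp\partial_\tau\int_{-\infty}^{x_2}|\Omega_\pm(x_1,y,\tau)|^2\,dy.$$ Then, for every $t\in[0,T]$ and each choice of sign, the inner integral is finite for all $x\in\mathbb{R}^2$ and $\tau\in[0,t]$ and, for every $x$, differentiable in $\tau$ at almost every $\tau\in(0,t)$; the function $G_\pm|\partial_1^2b_2|^2$ is integrable on $\mathbb{R}^2\times(0,t)$; and $$\int_0^t\int_{\mathbb{R}^2}G_\pm\,|\partial_1^2b_2|^2\,dx\,d\tau\le C\big(E_0+E_0^{3/2}\big)(E_0+E_1)+C\,E_0^{1/2}A_\pm+C\,E_0\,A_\pm^{1/2},$$ where $E_0,E_1,A_\pm$ are evaluated at $t$ and $C$ is an absolute constant, independent of $T$, $t$, the sign and the solution. -/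

import Mathlib

open MeasureTheory Set
open scoped ENNReal NNReal

namespace MHD

/-- The standard basis vectors of the plane `ℝ × ℝ`; index `0` is the direction `x₁` and index `1`
the direction `x₂`. -/
def e : Fin 2 → ℝ × ℝ := ![(1, 0), (0, 1)]

/-- The spatial partial derivative of a function on the plane in the `j`-th direction. -/
noncomputable def pd (j : Fin 2) (f : ℝ × ℝ → ℝ) (x : ℝ × ℝ) : ℝ := fderiv ℝ f x (e j)

/-- The Laplacian on the plane. -/
noncomputable def lap (f : ℝ × ℝ → ℝ) (x : ℝ × ℝ) : ℝ := ∑ j, pd j (pd j f) x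

/-- The square of the `L²(ℝ²)` norm (possibly `∞`). -/
noncomputable def sqL2 (f : ℝ × ℝ → ℝ) : ℝ≥0∞ := ∫⁻ x, ENNReal.ofReal (f x ^ 2)

/-- The square of the `H¹(ℝ²)` norm (possibly `∞`) of a `C¹` function. -/
noncomputable def sqH1 (f : ℝ × ℝ → ℝ) : ℝ≥0∞ := sqL2 f + ∑ i, sqL2 (pd i f)

/-- The square of the `H²(ℝ²)` norm (possibly `∞`) of a `C²` function. -/
noncomputable def sqH2 (f : ℝ × ℝ → ℝ) : ℝ≥0∞ :=
  sqL2 f + ∑ i, sqL2 (pd i f) + ∑ i, ∑ j, sqL2 (pd i (pd j f))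

/-- `E₀(t) = sup_{0 ≤ τ ≤ t} (‖u(τ)‖²_{H²} + ‖b(τ)‖²_{H²}) + ∫₀ᵗ ‖∇u(τ)‖²_{H²} dτ`.
A time dependent vector field is given by its components: `u i τ x` is the `i`-th component
at time `τ` and at the point `x`. -/
noncomputable def E₀ (u b : Fin 2 → ℝ → ℝ × ℝ → ℝ) (t : ℝ) : ℝ≥0∞ :=
  (⨆ τ ∈ Icc 0 t, ((∑ i, sqH2 (u i τ)) + ∑ i, sqH2 (b i τ)))
    + ∫⁻ τ in Ioo 0 t, ∑ i, ∑ j, sqH2 (pd j (u i τ))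

/-- `E₁(t) = ∫₀ᵗ ‖∂₂ b(τ)‖²_{H¹} dτ`. -/
noncomputable def E₁ (b : Fin 2 → ℝ → ℝ × ℝ → ℝ) (t : ℝ) : ℝ≥0∞ :=
  ∫⁻ τ in Ioo 0 t, ∑ i, sqH1 (pd 1 (b i τ))

/-- The partial Elsässer variable `Ω_± = u₁ ± b₁`; the sign is `σ = 1` or `σ = -1`. -/
def Om (σ : ℝ) (u b : Fin 2 → ℝ → ℝ × ℝ → ℝ) (τ : ℝ) (x : ℝ × ℝ) : ℝ :=
  u 0 τ x + σ * b 0 τ x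

/-- The weight `∂₁² b₂`. -/
noncomputable def d11b2 (b : Fin 2 → ℝ → ℝ × ℝ → ℝ) (τ : ℝ) (x : ℝ × ℝ) : ℝ :=
  pd 0 (pd 0 (b 1 τ)) x

/-- `A_±(t) = ∫₀ᵗ ∫ |Ω_±|² |∂₁² b₂|² dx dτ`. -/
noncomputable def A (σ : ℝ) (u b : Fin 2 → ℝ → ℝ × ℝ → ℝ) (t : ℝ) : ℝ≥0∞ :=
  ∫⁻ τ in Ioo 0 t, ∫⁻ x, ENNReal.ofReal (Om σ u b τ x ^ 2 * d11b2 b τ x ^ 2)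

/-- `∫_{-∞}^{x₂} |Ω_±(τ, x₁, y)|² dy`. -/
noncomputable def prim (σ : ℝ) (u b : Fin 2 → ℝ → ℝ × ℝ → ℝ) (τ : ℝ) (x : ℝ × ℝ) : ℝ :=
  ∫ y in Iic x.2, Om σ u b τ (x.1, y) ^ 2

/-- `G_± = |Ω_±|² ∓ ∂ₜ ∫_{-∞}^{x₂} |Ω_±|² dy`. -/
noncomputable def G (σ : ℝ) (u b : Fin 2 → ℝ → ℝ × ℝ → ℝ) (τ : ℝ) (x : ℝ × ℝ) : ℝ :=
  Om σ u b τ x ^ 2 - σ * deriv (fun s => prim σ u b s x) τ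

/-- Classical solutions `(u, b, P)` on `[0, T] × ℝ²`, with finite energy, of the viscous and
non-resistive MHD equations perturbed around the background magnetic field `(0, 1)`. -/
structure IsSolution (T : ℝ) (u b : Fin 2 → ℝ → ℝ × ℝ → ℝ) (P : ℝ → ℝ × ℝ → ℝ) : Prop where
  smooth_u : ∀ i, ContDiffOn ℝ 3 (fun z : ℝ × (ℝ × ℝ) => u i z.1 z.2) (Icc 0 T ×ˢ univ)
  smooth_b : ∀ i, ContDiffOn ℝ 2 (fun z : ℝ × (ℝ × ℝ) => b i z.1 z.2) (Icc 0 T ×ˢ univ)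
  smooth_P : ContDiffOn ℝ 1 (fun z : ℝ × (ℝ × ℝ) => P z.1 z.2) (Icc 0 T ×ˢ univ)
  momentum : ∀ τ ∈ Ioo 0 T, ∀ x, ∀ i,
    deriv (fun s => u i s x) τ + ∑ j, u j τ x * pd j (u i τ) x - lap (u i τ) x + pd i (P τ) x
      = ∑ j, b j τ x * pd j (b i τ) x + pd 1 (b i τ) x
  induction : ∀ τ ∈ Ioo 0 T, ∀ x, ∀ i,
    deriv (fun s => b i s x) τ + ∑ j, u j τ x * pd j (b i τ) x
      = ∑ j, b j τ x * pd j (u i τ) x + pd 1 (u i τ) x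
  div_u : ∀ τ ∈ Icc 0 T, ∀ x, ∑ j, pd j (u j τ) x = 0
  div_b : ∀ τ ∈ Icc 0 T, ∀ x, ∑ j, pd j (b j τ) x = 0
  finite_energy : E₀ u b T < ∞
  /-- The pressure gradient is square integrable, which fixes the pressure up to a function
  of time: `∇P = ∇ (-Δ)⁻¹ ∑ ∂ᵢ ∂ⱼ (uᵢ uⱼ - bᵢ bⱼ)`. -/
  pressure : ∀ τ ∈ Icc 0 T, ∀ i, sqL2 (pd i (P τ)) < ∞

end MHD

/-!
Write `σ = ±1`, `Ω = u₁ + σ b₁`, `v = u - σ b` and `φ = ∂₂u₁ - ∂₁u₂`, so that `Δu₁ = ∂₂φ`. The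
equation of `u₁` plus `σ` times that of `b₁` is
`∂ₜΩ = ∂₂φ - ∂₁P - v · ∇Ω + σ ∂₂Ω` (`IsSolution.hasDerivAt_Om`).
Multiplied by `2 Ω` and integrated over `(-∞, x₂)`, the last term yields `σ Ω²`, which is cancelled in
`G = Ω² - σ ∂ₜ ∫_{-∞}^{x₂} Ω²`; after integrating the viscous term by parts,
`G = -2 σ (Ω φ - ∫_{-∞}^{x₂} φ ∂₂Ω - ∫_{-∞}^{x₂} Ω (∂₁P + v · ∇Ω))`.

The weight `|∂₁²b₂|²` is bounded by `E₀` in `L¹(ℝ²)`, uniformly in time and no better, so the two integrals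
have to be bounded uniformly in `x` by multiples of `κ²`, where `κ(τ)²` is the sum of `‖∇u‖²_{H²}` and
`‖∂₂b‖²_{H¹}`, whose time integral is at most `E₀ + E₁`. On a vertical line
`‖f(a, ·)‖² ≤ 2 ‖f‖ ‖∂₁f‖` (`lineSq_le`). Hence `∂₂Ω` and `φ` gain a full factor `κ` there, and so does
`∂₁Ω`, since `∂₁u₁ = -∂₂u₂` and `∂₁b₁ = -∂₂b₂`. For the same reason `Ω` gains `κ^{1/2}` on vertical
lines (`TimeSlice.lineSq_els_le`), and `v` gains `κ^{1/2}` in `L^∞`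
(`Controlled.enorm_sq_le`); here and below the `H²` bound of `u` and `b` supplies the remaining
powers. This settles `∫ φ ∂₂Ω` and `∫ Ω v · ∇Ω`.

The pressure has to gain `κ^{3/2}` (`lineSq_pressure_le`). As the fields are divergence free,
`ΔP = div V` with `V = 2 (b₂ ∂₂b - u₂ ∂₂u)`, and both `V` and `div V` are sums of products with one
factor that gains `κ` and one that gains `κ^{1/2}` (`sqL2_mul_le`). Since `∇P ∈ L²`, the energy estimate
`‖∇P‖ ≤ ‖V‖` holds (`sum_sqL2_pd_le`, by cutoffs and the Poincaré inequality on squares), and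
applied to difference quotients it gives `‖∂₁²P‖ ≤ ‖ΔP‖` (`sqL2_pd_zero_pd_zero_le`).

The boundary term `Ω φ |∂₁²b₂|²` is estimated by Cauchy–Schwarz and `‖φ‖_∞ ≲ ‖∇u‖_{H²}`, which gives
`E₀ A^{1/2}` (`IsSolution.lintegral_boundary_le`). The term `E₀^{1/2} A` on the right-hand side is
not needed, because the transport term is estimated without integrating it by parts.

The time derivative of `∫_{-∞}^{x₂} Ω²` exists almost everywhere because this integral is absolutely
continuous in time: the bounds above show that `Ω ∂ₜΩ` is integrable over `(0, T)` times a vertical line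
(`IsSolution.prim_eq`). Lebesgue differentiation with a parameter (`ae_hasDerivAt_primitive`) makes the
formula for the derivative valid almost everywhere on `(0, T) × ℝ²`.
-/

namespace MHD

/-! ### Partial derivatives on the plane -/

lemma contDiff_pd {n : ℕ} {f : ℝ × ℝ → ℝ} (hf : ContDiff ℝ (n + 1 : ℕ) f) (j : Fin 2) :
    ContDiff ℝ n (pd j f) :=
  (hf.fderiv_right (m := n) (by norm_cast)).clm_apply contDiff_const

lemma continuous_pd {f : ℝ × ℝ → ℝ} (hf : ContDiff ℝ 1 f) (j : Fin 2) : Continuous (pd j f) :=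
  (contDiff_pd (n := 0) hf j).continuous

lemma hasDerivAt_fst {f : ℝ × ℝ → ℝ} (hf : ContDiff ℝ 1 f) (s y : ℝ) :
    HasDerivAt (fun s => f (s, y)) (pd 0 f (s, y)) s := by
  have h := (hf.differentiable one_ne_zero (s, y)).hasFDerivAt
  exact h.comp_hasDerivAt s ((hasDerivAt_id s).prodMk (hasDerivAt_const s y))

lemma hasDerivAt_snd {f : ℝ × ℝ → ℝ} (hf : ContDiff ℝ 1 f) (a y : ℝ) :
    HasDerivAt (fun y => f (a, y)) (pd 1 f (a, y)) y := by
  have h := (hf.differentiable one_ne_zero (a, y)).hasFDerivAt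
  exact h.comp_hasDerivAt y ((hasDerivAt_const y a).prodMk (hasDerivAt_id y))

lemma pd_add {f g : ℝ × ℝ → ℝ} {x : ℝ × ℝ} (hf : DifferentiableAt ℝ f x)
    (hg : DifferentiableAt ℝ g x) (j : Fin 2) :
    pd j (fun x => f x + g x) x = pd j f x + pd j g x := by
  simp [pd, fderiv_fun_add hf hg]

lemma pd_sub {f g : ℝ × ℝ → ℝ} {x : ℝ × ℝ} (hf : DifferentiableAt ℝ f x)
    (hg : DifferentiableAt ℝ g x) (j : Fin 2) :
    pd j (fun x => f x - g x) x = pd j f x - pd j g x := by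
  simp [pd, fderiv_fun_sub hf hg]

lemma pd_mul {f g : ℝ × ℝ → ℝ} {x : ℝ × ℝ} (hf : DifferentiableAt ℝ f x)
    (hg : DifferentiableAt ℝ g x) (j : Fin 2) :
    pd j (fun x => f x * g x) x = f x * pd j g x + pd j f x * g x := by
  simp [pd, fderiv_fun_mul hf hg]; ring

lemma pd_const_mul {f : ℝ × ℝ → ℝ} {x : ℝ × ℝ} (hf : DifferentiableAt ℝ f x) (c : ℝ) (j : Fin 2) :
    pd j (fun x => c * f x) x = c * pd j f x := by
  simp [pd, fderiv_const_mul hf]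

lemma pd_neg (f : ℝ × ℝ → ℝ) (x : ℝ × ℝ) (j : Fin 2) :
    pd j (fun x => -f x) x = -pd j f x := by
  simp [pd]

lemma pd_comm {f : ℝ × ℝ → ℝ} (hf : ContDiff ℝ 2 f) (i j : Fin 2) :
    pd i (pd j f) = pd j (pd i f) := by
  funext x
  have hd : DifferentiableAt ℝ (fderiv ℝ f) x :=
    (hf.fderiv_right (m := 1) (by norm_num)).differentiable one_ne_zero x
  have key : ∀ i j, pd i (pd j f) x = fderiv ℝ (fderiv ℝ f) x (e i) (e j) := by
    intro i j
    have : pd j f = fun x => fderiv ℝ f x (e j) := rfl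
    rw [pd, this, fderiv_clm_apply hd (differentiableAt_const _)]
    simp
  rw [key, key]
  exact (hf.contDiffAt.isSymmSndFDerivAt (by simp)) _ _

/-! ### Anisotropic interpolation inequalities -/

lemma ofReal_sq_eq_enorm (r : ℝ) : ENNReal.ofReal (r ^ 2) = ‖r‖ₑ ^ 2 := by
  rw [← enorm_pow, Real.enorm_of_nonneg (sq_nonneg r)]

lemma sqL2_eq (f : ℝ × ℝ → ℝ) : sqL2 f = ∫⁻ x, ‖f x‖ₑ ^ 2 := by
  simp only [sqL2, ofReal_sq_eq_enorm]

/-- The square of the `L²` norm of `f` on the vertical line `{x₁ = a}` (possibly `∞`). -/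
noncomputable def lineSq (f : ℝ × ℝ → ℝ) (a : ℝ) : ℝ≥0∞ := ∫⁻ y, ‖f (a, y)‖ₑ ^ 2

/-- The Cauchy–Schwarz inequality for lower Lebesgue integrals. -/
lemma sq_lintegral_mul_le {α : Type*} [MeasurableSpace α] {μ : Measure α} {f g : α → ℝ}
    (hf : AEMeasurable f μ) (hg : AEMeasurable g μ) :
    (∫⁻ x, ‖f x * g x‖ₑ ∂μ) ^ 2 ≤ (∫⁻ x, ‖f x‖ₑ ^ 2 ∂μ) * ∫⁻ x, ‖g x‖ₑ ^ 2 ∂μ := by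
  have h := ENNReal.lintegral_mul_le_Lp_mul_Lq μ Real.HolderConjugate.two_two hf.enorm hg.enorm
  simp only [Pi.mul_apply, ENNReal.rpow_two] at h
  simp only [enorm_mul]
  refine (pow_le_pow_left' h 2).trans (le_of_eq ?_)
  rw [mul_pow]
  congr 1 <;>
  · rw [← ENNReal.rpow_natCast, ← ENNReal.rpow_mul]; norm_num

/-- The one-dimensional Agmon inequality `‖f‖²_{L^∞} ≤ 2 ‖f f'‖_{L¹}`. -/
lemma enorm_sq_le_two_mul_lintegral {f f' : ℝ → ℝ} (hf : ∀ x, HasDerivAt f (f' x) x)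
    (hc : Continuous f') (hfin : ∫⁻ s, ‖f s‖ₑ ^ 2 ≠ ∞) (a : ℝ) :
    ‖f a‖ₑ ^ 2 ≤ 2 * ∫⁻ s, ‖f s * f' s‖ₑ := by
  have hfc : Continuous f := continuous_iff_continuousAt.2 fun x => (hf x).continuousAt
  have key : ∀ s, ‖f a‖ₑ ^ 2 ≤ ‖f s‖ₑ ^ 2 + 2 * ∫⁻ s, ‖f s * f' s‖ₑ := by
    intro s
    have h1 : ∫ r in s..a, 2 * (f r * f' r) = f a ^ 2 - f s ^ 2 := by
      refine intervalIntegral.integral_eq_sub_of_hasDerivAt (f := fun r => f r ^ 2)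
        (fun r _ => ?_) ?_
      · have := (hf r).fun_pow 2
        simpa [mul_assoc] using this
      · exact (by fun_prop : Continuous fun r => 2 * (f r * f' r)).intervalIntegrable _ _
    have h2 : ‖∫ r in s..a, 2 * (f r * f' r)‖ₑ ≤ 2 * ∫⁻ s, ‖f s * f' s‖ₑ := by
      rw [← lintegral_const_mul _ (by fun_prop)]
      rw [← ofReal_norm, intervalIntegral.norm_integral_eq_norm_integral_uIoc,
        ofReal_norm]
      refine (enorm_integral_le_lintegral_enorm _).trans ((setLIntegral_le_lintegral _ _).trans ?_)
      refine lintegral_mono fun r => ?_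
      rw [enorm_mul]
      gcongr
      simp [Real.enorm_eq_ofReal]
    rw [← enorm_pow, ← enorm_pow]
    calc ‖f a ^ 2‖ₑ = ‖f s ^ 2 + ∫ r in s..a, 2 * (f r * f' r)‖ₑ := by rw [h1]; congr 1; ring
      _ ≤ _ := (enorm_add_le _ _).trans (by gcongr)
  by_contra! hlt
  have hpos : ∀ s, ‖f a‖ₑ ^ 2 - 2 * ∫⁻ s, ‖f s * f' s‖ₑ ≤ ‖f s‖ₑ ^ 2 := fun s =>
    tsub_le_iff_right.2 (key s)
  have h3 := (lintegral_mono hpos).trans_lt (lt_top_iff_ne_top.2 hfin)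
  rw [lintegral_const] at h3
  have h4 : ‖f a‖ₑ ^ 2 - 2 * ∫⁻ s, ‖f s * f' s‖ₑ ≠ 0 := (tsub_pos_of_lt hlt).ne'
  rw [Real.volume_univ, ENNReal.mul_top h4] at h3
  exact lt_irrefl _ h3

/-- `∬ |f g| ≤ m k` if `‖f‖ ≤ m` and `‖g‖ ≤ k` in `L²`. -/
lemma lintegral_mul_le_of_sqL2_le {f g : ℝ × ℝ → ℝ} (hf : Continuous f) (hg : Continuous g)
    {m k : ℝ≥0} (hm : sqL2 f ≤ m ^ 2) (hk : sqL2 g ≤ k ^ 2) :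
    ∫⁻ x, ‖f x * g x‖ₑ ≤ m * k := by
  rw [sqL2_eq] at hm hk
  rw [← ENNReal.pow_le_pow_left_iff two_ne_zero]
  refine (sq_lintegral_mul_le hf.aemeasurable hg.aemeasurable).trans ?_
  rw [mul_pow]
  gcongr

lemma enorm_sq_le_of_lineSq_le {f : ℝ × ℝ → ℝ} (hf : ContDiff ℝ 1 f) {m k : ℝ≥0} {a : ℝ}
    (hm : lineSq f a ≤ m) (hk : lineSq (pd 1 f) a ≤ k) (y : ℝ) :
    (‖f (a, y)‖ₑ ^ 2) ^ 2 ≤ 4 * m * k := by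
  have hc := continuous_pd hf 1
  have h := enorm_sq_le_two_mul_lintegral (hasDerivAt_snd hf a) (by fun_prop)
    (ne_top_of_le_ne_top ENNReal.coe_ne_top hm) y
  refine (pow_le_pow_left' h 2).trans ?_
  rw [mul_pow, mul_assoc]
  refine mul_le_mul' (by norm_num) ((sq_lintegral_mul_le ?_ ?_).trans (mul_le_mul' hm hk))
  · exact (hf.continuous.comp (by fun_prop)).aemeasurable
  · exact (hc.comp (by fun_prop)).aemeasurable

/-- The trace inequality `‖f(a, ·)‖²_{L²} ≤ 2 ‖f‖ ‖∂₁f‖` on vertical lines. -/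
lemma lineSq_le {f : ℝ × ℝ → ℝ} (hf : ContDiff ℝ 1 f) {m k : ℝ≥0}
    (hm : sqL2 f ≤ m ^ 2) (hk : sqL2 (pd 0 f) ≤ k ^ 2) (a : ℝ) : lineSq f a ≤ 2 * m * k := by
  have hc := continuous_pd hf 0
  have hfc := hf.continuous
  have hfm := hfc.measurable
  have hfin : ∀ᵐ y : ℝ, ∫⁻ s, ‖f (s, y)‖ₑ ^ 2 < ∞ := by
    refine ae_lt_top' (Measurable.lintegral_prod_left' (f := fun x => ‖f x‖ₑ ^ 2)
      (by fun_prop)).aemeasurable ?_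
    rw [lintegral_lintegral_symm (f := fun y s => ‖f (s, y)‖ₑ ^ 2) (by
        exact (Measurable.aemeasurable (by fun_prop)))]
    rw [sqL2_eq] at hm
    exact ne_top_of_le_ne_top (by simp) hm
  calc lineSq f a ≤ ∫⁻ y, 2 * ∫⁻ s, ‖f (s, y) * pd 0 f (s, y)‖ₑ := by
        refine lintegral_mono_ae (hfin.mono fun y hy => ?_)
        exact enorm_sq_le_two_mul_lintegral (fun s => hasDerivAt_fst hf s y)
          (by fun_prop) hy.ne a
    _ = 2 * ∫⁻ x, ‖f x * pd 0 f x‖ₑ := by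
        rw [lintegral_const_mul' _ _ (by simp),
          lintegral_lintegral_symm (f := fun y s => ‖f (s, y) * pd 0 f (s, y)‖ₑ)
            (by exact (Measurable.aemeasurable (by fun_prop)))]
        rfl
    _ ≤ 2 * m * k := by
        rw [mul_assoc]
        gcongr
        exact lintegral_mul_le_of_sqL2_le hfc hc hm hk

/-- The anisotropic product estimate `‖f g‖² ≤ (2 ‖f‖ ‖∂₂f‖) (2 ‖g‖ ‖∂₁g‖)`: the factor `f` is
estimated in `L²_{x₁} L^∞_{x₂}` and the factor `g` in `L^∞_{x₁} L²_{x₂}`. -/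
lemma sqL2_mul_le {f g : ℝ × ℝ → ℝ} (hf : ContDiff ℝ 1 f) (hg : ContDiff ℝ 1 g)
    {m k m' k' : ℝ≥0} (hm : sqL2 f ≤ m ^ 2) (hk : sqL2 (pd 1 f) ≤ k ^ 2)
    (hm' : sqL2 g ≤ m' ^ 2) (hk' : sqL2 (pd 0 g) ≤ k' ^ 2) :
    sqL2 (fun x => f x * g x) ≤ (2 * m * k) * (2 * m' * k') := by
  have hc := continuous_pd hf 1
  have hfc := hf.continuous
  have hgc := hg.continuous
  have hgm := hgc.measurable
  have hfin : ∀ᵐ a : ℝ, ∫⁻ y, ‖f (a, y)‖ₑ ^ 2 < ∞ := by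
    refine ae_lt_top' (Measurable.lintegral_prod_right' (f := fun x => ‖f x‖ₑ ^ 2)
      (by fun_prop)).aemeasurable ?_
    rw [← lintegral_prod (fun x => ‖f x‖ₑ ^ 2) (by fun_prop)]
    rw [sqL2_eq] at hm
    exact ne_top_of_le_ne_top (by simp) hm
  calc sqL2 (fun x => f x * g x) = ∫⁻ a, ∫⁻ y, ‖f (a, y) * g (a, y)‖ₑ ^ 2 := by
        rw [sqL2_eq]
        exact lintegral_prod (fun x => ‖f x * g x‖ₑ ^ 2) (by fun_prop)
    _ ≤ ∫⁻ a, (2 * ∫⁻ y, ‖f (a, y) * pd 1 f (a, y)‖ₑ) * (2 * m' * k') := by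
        refine lintegral_mono_ae (hfin.mono fun a ha => ?_)
        have h := enorm_sq_le_two_mul_lintegral (hasDerivAt_snd hf a) (by fun_prop) ha.ne
        calc ∫⁻ y, ‖f (a, y) * g (a, y)‖ₑ ^ 2
            ≤ ∫⁻ y, (2 * ∫⁻ y, ‖f (a, y) * pd 1 f (a, y)‖ₑ) * ‖g (a, y)‖ₑ ^ 2 := by
              refine lintegral_mono fun y => ?_
              rw [enorm_mul, mul_pow]
              gcongr
              exact h y
          _ = (2 * ∫⁻ y, ‖f (a, y) * pd 1 f (a, y)‖ₑ) * lineSq g a :=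
              lintegral_const_mul _ (by fun_prop)
          _ ≤ _ := by gcongr; exact lineSq_le hg hm' hk' a
    _ = 2 * (∫⁻ x, ‖f x * pd 1 f x‖ₑ) * (2 * m' * k') := by
        rw [lintegral_mul_const' _ _ (by finiteness), lintegral_const_mul' _ _ (by simp)]
        congr 2
        exact (lintegral_prod (fun x => ‖f x * pd 1 f x‖ₑ) (by fun_prop)).symm
    _ ≤ _ := by
        rw [mul_assoc 2 (m : ℝ≥0∞)]
        gcongr
        exact lintegral_mul_le_of_sqL2_le hfc hc hm hk

end MHD

namespace MHD

/-! ### The energy estimate for `ΔP = div V` -/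

lemma enorm_add_sq_le (p q : ℝ) : ‖p + q‖ₑ ^ 2 ≤ 2 * ‖p‖ₑ ^ 2 + 2 * ‖q‖ₑ ^ 2 := by
  simp only [← ofReal_sq_eq_enorm]
  rw [← ENNReal.ofReal_ofNat, ← ENNReal.ofReal_mul (by norm_num),
    ← ENNReal.ofReal_mul (by norm_num), ← ENNReal.ofReal_add (by positivity) (by positivity)]
  exact ENNReal.ofReal_le_ofReal (by nlinarith [sq_nonneg (p - q)])

lemma enorm_sub_sq_le_mul_lintegral {f f' : ℝ → ℝ} (hf : ∀ x, HasDerivAt f (f' x) x)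
    (hc : Continuous f') {R x y : ℝ} (hx : x ∈ Icc (-R) R) (hy : y ∈ Icc (-R) R) :
    ‖f x - f y‖ₑ ^ 2 ≤ ENNReal.ofReal (2 * R) * ∫⁻ s, ‖f' s‖ₑ ^ 2 := by
  have h1 : ∫ r in y..x, f' r = f x - f y :=
    intervalIntegral.integral_eq_sub_of_hasDerivAt (fun r _ => hf r) (hc.intervalIntegrable _ _)
  have h2 : ‖f x - f y‖ₑ ≤ ∫⁻ s in Icc (-R) R, ‖1 * f' s‖ₑ := by
    simp only [one_mul]
    rw [← h1, ← ofReal_norm, intervalIntegral.norm_integral_eq_norm_integral_uIoc, ofReal_norm]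
    refine (enorm_integral_le_lintegral_enorm _).trans (lintegral_mono_set ?_)
    exact Set.uIoc_subset_uIcc.trans (Set.uIcc_subset_Icc hy hx)
  refine (pow_le_pow_left' h2 2).trans ((sq_lintegral_mul_le (by fun_prop)
    hc.aemeasurable).trans ?_)
  refine mul_le_mul' ?_ (setLIntegral_le_lintegral _ _)
  simp only [enorm_one, one_pow, lintegral_const, Measure.restrict_apply_univ, Real.volume_Icc,
    one_mul]
  rw [sub_neg_eq_add, two_mul]

/-- The Poincaré inequality on the square `[-R, R]²`, with the gradient over the whole plane on
the right-hand side. The subtracted constant is the value of the function at a point of a vertical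
line that carries at most the average of `|∂₂P|²`. -/
lemma exists_lintegral_sub_sq_le {P : ℝ × ℝ → ℝ} (hP : ContDiff ℝ 1 P) {R : ℝ} (hR : 0 < R) :
    ∃ c : ℝ, ∫⁻ x in Icc (-R) R ×ˢ Icc (-R) R, ‖P x - c‖ₑ ^ 2 ≤
      ENNReal.ofReal (8 * R ^ 2) * ∑ i, sqL2 (pd i P) := by
  have hc0 := continuous_pd hP 0
  have hc1 := continuous_pd hP 1
  have hm0 := hc0.measurable
  have hm1 := hc1.measurable
  have hvol : volume (Icc (-R) R) = ENNReal.ofReal (2 * R) := by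
    rw [Real.volume_Icc]; ring_nf
  have hv0 : ENNReal.ofReal (2 * R) ≠ 0 := by simpa using hR
  obtain ⟨a, ha, hle⟩ := exists_le_setLAverage (μ := volume) (s := Icc (-R) R)
    (f := lineSq (pd 1 P)) (by rw [hvol]; exact hv0) (by rw [hvol]; exact ENNReal.ofReal_ne_top)
    (Measurable.lintegral_prod_right' (f := fun x => ‖pd 1 P x‖ₑ ^ 2) (by fun_prop)).aemeasurable
  have hle' : ENNReal.ofReal (2 * R) * lineSq (pd 1 P) a ≤ sqL2 (pd 1 P) := by
    rw [setLAverage_eq, hvol] at hle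
    have h := (ENNReal.le_div_iff_mul_le (Or.inl hv0) (Or.inl ENNReal.ofReal_ne_top)).1 hle
    rw [mul_comm]
    refine h.trans ((setLIntegral_le_lintegral _ _).trans (le_of_eq ?_))
    rw [sqL2_eq]
    exact (lintegral_prod (fun x => ‖pd 1 P x‖ₑ ^ 2) (by fun_prop)).symm
  have h0mem : (0 : ℝ) ∈ Icc (-R) R := ⟨by linarith, hR.le⟩
  refine ⟨P (a, 0), ?_⟩
  set L := ENNReal.ofReal (2 * R) with hL
  have hpt : ∀ x ∈ Icc (-R) R ×ˢ Icc (-R) R, ‖P x - P (a, 0)‖ₑ ^ 2 ≤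
      2 * (L * ∫⁻ s, ‖pd 0 P (s, x.2)‖ₑ ^ 2) + 2 * (L * lineSq (pd 1 P) a) := by
    rintro ⟨x, y⟩ ⟨hx, hy⟩
    have h := enorm_add_sq_le (P (x, y) - P (a, y)) (P (a, y) - P (a, 0))
    rw [sub_add_sub_cancel] at h
    refine h.trans (add_le_add (mul_le_mul' le_rfl ?_) (mul_le_mul' le_rfl ?_))
    · exact enorm_sub_sq_le_mul_lintegral (fun s => hasDerivAt_fst hP s y) (by fun_prop) hx ha
    · exact enorm_sub_sq_le_mul_lintegral (fun s => hasDerivAt_snd hP a s) (by fun_prop) hy h0mem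
  calc ∫⁻ x in Icc (-R) R ×ˢ Icc (-R) R, ‖P x - P (a, 0)‖ₑ ^ 2
      ≤ ∫⁻ x in Icc (-R) R ×ˢ Icc (-R) R, (2 * (L * ∫⁻ s, ‖pd 0 P (s, x.2)‖ₑ ^ 2)
          + 2 * (L * lineSq (pd 1 P) a)) :=
        setLIntegral_mono' (measurableSet_Icc.prod measurableSet_Icc) hpt
    _ = L * (2 * (L * ∫⁻ y in Icc (-R) R, ∫⁻ s, ‖pd 0 P (s, y)‖ₑ ^ 2))
          + L * (2 * (L * (L * lineSq (pd 1 P) a))) := by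
        have hmeas : Measurable fun y : ℝ => ∫⁻ s, ‖pd 0 P (s, y)‖ₑ ^ 2 :=
          Measurable.lintegral_prod_left' (f := fun x => ‖pd 0 P x‖ₑ ^ 2) (by fun_prop)
        rw [lintegral_add_right _ (by fun_prop), setLIntegral_const, Measure.volume_eq_prod,
          setLIntegral_prod _ (by fun_prop), Measure.prod_prod]
        dsimp only
        rw [setLIntegral_const, hvol, lintegral_const_mul _ (by fun_prop),
          lintegral_const_mul _ (by fun_prop)]
        ring
    _ ≤ L * (2 * (L * sqL2 (pd 0 P))) + L * (2 * (L * sqL2 (pd 1 P))) := by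
        gcongr
        refine (setLIntegral_le_lintegral _ _).trans (le_of_eq ?_)
        rw [lintegral_lintegral_symm (f := fun y s => ‖pd 0 P (s, y)‖ₑ ^ 2)
            (by exact (Measurable.aemeasurable (by fun_prop))), sqL2_eq]
        rfl
    _ = ENNReal.ofReal (8 * R ^ 2) * ∑ i, sqL2 (pd i P) := by
        have : ENNReal.ofReal (8 * R ^ 2) = L * 2 * L := by
          rw [hL, ← ENNReal.ofReal_ofNat, ← ENNReal.ofReal_mul (by positivity),
            ← ENNReal.ofReal_mul (by positivity)]
          congr 1; ring
        rw [this, Fin.sum_univ_two]; ring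

lemma memLp_two_of_sqL2 {f : ℝ × ℝ → ℝ} (hf : Continuous f) (h : sqL2 f < ∞) : MemLp f 2 := by
  rw [memLp_two_iff_integrable_sq hf.aestronglyMeasurable]
  refine ⟨(by fun_prop : Continuous fun x => f x ^ 2).aestronglyMeasurable, ?_⟩
  rw [hasFiniteIntegral_iff_enorm]
  simpa only [enorm_pow, sqL2_eq] using h

lemma sqL2_eq_ofReal {f : ℝ × ℝ → ℝ} (hf : MemLp f 2) :
    sqL2 f = ENNReal.ofReal (∫ x, f x ^ 2) := by
  rw [ofReal_integral_eq_lintegral_ofReal hf.integrable_sq (ae_of_all _ fun x => sq_nonneg _)]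
  rfl

/-- If `∇P - V` is a divergence-free square-integrable field, then `∇P` is orthogonal to it. The
cutoff at scale `n` is tested against `P - c`, where `c` comes from the Poincaré inequality on the
square of side `4 (n + 1)`; the error is controlled by the tail of `∇P - V`. -/
lemma integral_grad_mul_eq_zero {P : ℝ × ℝ → ℝ} (hP : ContDiff ℝ 1 P)
    {W W' : Fin 2 → ℝ × ℝ → ℝ} (hWc : ∀ i, Continuous (W i)) (hW'c : ∀ i, Continuous (W' i))
    (hW : ∀ i x, HasLineDerivAt ℝ (W i) (W' i x) x (e i)) (hdiv : ∀ x, ∑ i, W' i x = 0)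
    (hP2 : ∀ i, sqL2 (pd i P) < ∞) (hW2 : ∀ i, sqL2 (W i) < ∞) :
    ∫ x, ∑ i, pd i P x * W i x = 0 := by
  have hPc := hP.continuous
  have hpc := fun i => continuous_pd hP i
  let χ : ContDiffBump (0 : ℝ × ℝ) := ⟨1, 2, one_pos, one_lt_two⟩
  have hχ : ContDiff ℝ 1 χ := χ.contDiff
  have hχc := fun i => continuous_pd hχ i
  have hχsupp : HasCompactSupport χ := χ.hasCompactSupport
  have hout : ∀ i x, 2 < ‖x‖ → pd i χ x = 0 := by
    intro i x hx
    have : (χ : ℝ × ℝ → ℝ) =ᶠ[nhds x] fun _ => 0 := by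
      filter_upwards [(isOpen_lt continuous_const continuous_norm).mem_nhds hx] with z hz
      exact χ.zero_of_le_dist (by simpa using (le_of_lt hz : (2:ℝ) ≤ ‖z‖))
    simp [pd, this.fderiv_eq]
  have hin : ∀ i x, ‖x‖ < 1 → pd i χ x = 0 := by
    intro i x hx
    have : (χ : ℝ × ℝ → ℝ) =ᶠ[nhds x] fun _ => 1 := by
      filter_upwards [(isOpen_lt continuous_norm continuous_const).mem_nhds hx] with z hz
      exact χ.one_of_mem_closedBall (by simpa using (le_of_lt hz : ‖z‖ ≤ (1:ℝ)))
    simp [pd, this.fderiv_eq]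
  have hK : ∀ i, ∃ K : ℝ≥0, ∀ x, ‖pd i χ x‖ₑ ≤ K := by
    intro i
    have hcs : HasCompactSupport (pd i χ) := hχsupp.fderiv_apply (𝕜 := ℝ) (e i)
    obtain ⟨K, hK⟩ := (hχc i).bounded_above_of_compact_support hcs
    refine ⟨K.toNNReal, fun x => ?_⟩
    rw [← ofReal_norm]
    exact ENNReal.ofReal_le_ofReal (hK x)
  choose K hK using hK
  let r : ℕ → ℝ := fun n => ((n : ℝ) + 1)⁻¹
  have hr : ∀ n, 0 < r n := fun n => by positivity
  have hrlim : Filter.Tendsto r Filter.atTop (nhds 0) := by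
    simpa [r] using tendsto_one_div_add_atTop_nhds_zero_nat (𝕜 := ℝ)
  let η : ℕ → ℝ × ℝ → ℝ := fun n x => χ (r n • x)
  have hη : ∀ n, ContDiff ℝ 1 (η n) := fun n => hχ.comp (contDiff_const_smul (r n))
  have hηpd : ∀ n i x, pd i (η n) x = r n * pd i χ (r n • x) := by
    intro n i x
    have h1 : HasFDerivAt (fun x : ℝ × ℝ => r n • x)
        (r n • ContinuousLinearMap.id ℝ (ℝ × ℝ)) x := (hasFDerivAt_id x).const_smul (r n)
    have := ((hχ.differentiable one_ne_zero (r n • x)).hasFDerivAt.comp x h1).fderiv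
    change fderiv ℝ ((χ : ℝ × ℝ → ℝ) ∘ fun x => r n • x) x (e i) = _
    rw [this]
    simp [pd]
  have hηsupp : ∀ n, HasCompactSupport (η n) := fun n =>
    hχsupp.comp_homeomorph (Homeomorph.smulOfNeZero (r n) (hr n).ne')
  -- testing the divergence-free condition against `η (P - c)`
  have hident : ∀ n c, ∫ x, η n x * ∑ i, pd i P x * W i x =
      -∑ i, ∫ x, (P x - c) * (r n * (pd i χ (r n • x) * W i x)) := by
    intro n c
    have hηc := (hη n).continuous
    let φ : ℝ × ℝ → ℝ := fun x => η n x * (P x - c)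
    have hφ : ContDiff ℝ 1 φ := (hη n).mul (hP.sub contDiff_const)
    have hφc := hφ.continuous
    have hφs : HasCompactSupport φ := (hηsupp n).mul_right
    have hφpd : ∀ i x, pd i φ x = η n x * pd i P x + pd i (η n) x * (P x - c) := by
      intro i x
      have h2 := pd_mul ((hη n).differentiable one_ne_zero x)
        ((hP.sub (contDiff_const (c := c))).differentiable one_ne_zero x) i
      rw [show pd i φ x = _ from h2, pd_sub (hP.differentiable one_ne_zero x)
        (differentiableAt_const c)]
      simp [pd]
    have hφpc := fun i => continuous_pd hφ i
    have hparts : ∀ i, ∫ x, φ x * W' i x = -∫ x, pd i φ x * W i x := by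
      intro i
      refine integral_bilinear_hasLineDerivAt_right_eq_neg_left_of_integrable
        (B := ContinuousLinearMap.mul ℝ ℝ) (v := e i) (f' := pd i φ) (g := W i) (g' := W' i)
        ?_ ?_ ?_ (fun x _ => ?_) (fun x _ => hW i x)
      · exact ((hφpc i).mul (hWc i)).integrable_of_hasCompactSupport
          (hφs.fderiv_apply (𝕜 := ℝ) (e i)).mul_right
      · exact (hφc.mul (hW'c i)).integrable_of_hasCompactSupport hφs.mul_right
      · exact (hφc.mul (hWc i)).integrable_of_hasCompactSupport hφs.mul_right
      · exact (hφ.differentiable one_ne_zero x).hasFDerivAt.hasLineDerivAt (e i)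
    have hsum : ∑ i, ∫ x, pd i φ x * W i x = 0 := by
      rw [← neg_eq_zero, ← Finset.sum_neg_distrib]
      simp only [← hparts]
      have hi : ∀ i, Integrable fun x => φ x * W' i x := fun i =>
        (hφc.mul (hW'c i)).integrable_of_hasCompactSupport hφs.mul_right
      rw [← integral_finsetSum _ fun i _ => hi i]
      simp [← Finset.mul_sum, hdiv]
    have hi1 : ∀ i, Integrable fun x => η n x * (pd i P x * W i x) := fun i =>
      (hηc.mul ((hpc i).mul (hWc i))).integrable_of_hasCompactSupport (hηsupp n).mul_right
    have hsplit : ∀ i, ∫ x, pd i φ x * W i x = (∫ x, η n x * (pd i P x * W i x))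
        + ∫ x, (P x - c) * (r n * (pd i χ (r n • x) * W i x)) := by
      intro i
      have hi2 : Integrable fun x => pd i (η n) x * ((P x - c) * W i x) :=
        ((continuous_pd (hη n) i).mul ((hPc.sub continuous_const).mul
          (hWc i))).integrable_of_hasCompactSupport
          ((hηsupp n).fderiv_apply (𝕜 := ℝ) (e i)).mul_right
      have : (fun x => (P x - c) * (r n * (pd i χ (r n • x) * W i x))) =
          fun x => pd i (η n) x * ((P x - c) * W i x) := by
        funext x; rw [hηpd]; ring
      rw [this, ← integral_add (hi1 i) hi2]
      refine integral_congr_ae (ae_of_all _ fun x => ?_)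
      simp only [hφpd]; ring
    simp only [hsplit, Finset.sum_add_distrib] at hsum
    rw [← eq_neg_iff_add_eq_zero] at hsum
    rw [← hsum, ← integral_finsetSum _ fun i _ => hi1 i]
    simp only [Finset.mul_sum]
  have hS : Integrable fun x => ∑ i, pd i P x * W i x :=
    integrable_finsetSum _ fun i _ => (memLp_two_of_sqL2 (hpc i) (hP2 i)).integrable_mul
      (memLp_two_of_sqL2 (hWc i) (hW2 i))
  have hlim1 : Filter.Tendsto (fun n => ∫ x, η n x * ∑ i, pd i P x * W i x) Filter.atTop
      (nhds (∫ x, ∑ i, pd i P x * W i x)) := by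
    refine tendsto_integral_of_dominated_convergence
      (fun x => ‖∑ i, pd i P x * W i x‖) (fun n => ?_) hS.norm (fun n => ae_of_all _ fun x => ?_)
      (ae_of_all _ fun x => ?_)
    · exact ((hη n).continuous.mul (by fun_prop)).aestronglyMeasurable
    · rw [norm_mul]
      refine mul_le_of_le_one_left (norm_nonneg _) ?_
      rw [Real.norm_of_nonneg χ.nonneg]
      exact χ.le_one
    · have h1 : Filter.Tendsto (fun n => η n x) Filter.atTop (nhds (χ ((0:ℝ) • x))) :=
        (hχ.continuous.tendsto _).comp (hrlim.smul_const x)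
      rw [zero_smul, χ.one_of_mem_closedBall (by simp [χ])] at h1
      simpa using h1.mul_const (∑ i, pd i P x * W i x)
  -- the tails of `W`
  have htail : ∀ i, Filter.Tendsto (fun n => ∫⁻ x, ‖pd i χ (r n • x) * W i x‖ₑ ^ 2) Filter.atTop
      (nhds 0) := by
    intro i
    have hχm := (hχc i).measurable
    have hWm := (hWc i).measurable
    have := tendsto_lintegral_of_dominated_convergence (μ := volume)
      (F := fun n x => ‖pd i χ (r n • x) * W i x‖ₑ ^ 2) (f := fun _ => 0)
      (fun x => (K i : ℝ≥0∞) ^ 2 * ‖W i x‖ₑ ^ 2) (fun n => by fun_prop) (fun n => ae_of_all _ fun x => ?_)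
      ?_ (ae_of_all _ fun x => ?_)
    · simpa using this
    · simp only [enorm_mul, mul_pow]
      gcongr
      exact hK i _
    · rw [lintegral_const_mul _ (by fun_prop), ← sqL2_eq]
      exact ENNReal.mul_ne_top (by simp) (hW2 i).ne
    · refine tendsto_const_nhds.congr' ?_
      have h0 : Filter.Tendsto (fun n => ‖r n • x‖) Filter.atTop (nhds 0) := by
        simpa using (hrlim.smul_const x).norm
      filter_upwards [h0.eventually_lt_const one_pos] with n hn
      simp [hin i _ hn]
  have hlim2 : Filter.Tendsto (fun n => ∫ x, η n x * ∑ i, pd i P x * W i x) Filter.atTop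
      (nhds 0) := by
    set D := ∑ i, sqL2 (pd i P) with hD
    have hDfin : D ≠ ∞ := by simpa [hD, ENNReal.sum_eq_top] using fun i => (hP2 i).ne
    choose c hc using fun n => exists_lintegral_sub_sq_le hP
      (R := 2 * (r n)⁻¹) (by have := hr n; positivity)
    have hterm : ∀ i, Filter.Tendsto (fun n =>
        ∫ x, (P x - c n) * (r n * (pd i χ (r n • x) * W i x))) Filter.atTop (nhds 0) := by
      intro i
      have hχm := (hχc i).measurable
      have hWm := (hWc i).measurable
      have hPm := hPc.measurable
      have hbound : ∀ n, ‖∫ x, (P x - c n) * (r n * (pd i χ (r n • x) * W i x))‖ₑ ^ 2 ≤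
          ENNReal.ofReal 32 * D * ∫⁻ x, ‖pd i χ (r n • x) * W i x‖ₑ ^ 2 := by
        intro n
        set Q := Icc (-(2 * (r n)⁻¹)) (2 * (r n)⁻¹) ×ˢ Icc (-(2 * (r n)⁻¹)) (2 * (r n)⁻¹)
        have hQ : ∫ x, (P x - c n) * (r n * (pd i χ (r n • x) * W i x)) =
            ∫ x in Q, (P x - c n) * (r n * (pd i χ (r n • x) * W i x)) := by
          refine (setIntegral_eq_integral_of_forall_compl_eq_zero fun x hx => ?_).symm
          rw [hout i]
          · simp
          · by_contra! hle
            apply hx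
            rw [norm_smul, Real.norm_of_nonneg (hr n).le, mul_comm, ← le_div_iff₀ (hr n),
              div_eq_mul_inv] at hle
            have h1 := (norm_fst_le x).trans hle
            have h2 := (norm_snd_le x).trans hle
            exact ⟨abs_le.1 h1, abs_le.1 h2⟩
        rw [hQ]
        calc _ ≤ (∫⁻ x in Q, ‖(P x - c n) * (r n * (pd i χ (r n • x) * W i x))‖ₑ) ^ 2 :=
              pow_le_pow_left' (enorm_integral_le_lintegral_enorm _) 2
          _ ≤ (∫⁻ x in Q, ‖P x - c n‖ₑ ^ 2) *
              ∫⁻ x in Q, ‖r n * (pd i χ (r n • x) * W i x)‖ₑ ^ 2 :=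
              sq_lintegral_mul_le (by fun_prop) (by fun_prop)
          _ ≤ (ENNReal.ofReal (8 * (2 * (r n)⁻¹) ^ 2) * D) *
              ∫⁻ x, ‖r n * (pd i χ (r n • x) * W i x)‖ₑ ^ 2 :=
              mul_le_mul' (hc n) (setLIntegral_le_lintegral _ _)
          _ = _ := by
              simp only [enorm_mul (r n), mul_pow ‖r n‖ₑ]
              rw [lintegral_const_mul _ (by fun_prop), ← ofReal_sq_eq_enorm]
              have : ENNReal.ofReal 32 =
                  ENNReal.ofReal (8 * (2 * (r n)⁻¹) ^ 2) * ENNReal.ofReal (r n ^ 2) := by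
                rw [← ENNReal.ofReal_mul (by positivity)]
                congr 1
                have := (hr n).ne'
                field_simp; norm_num
              rw [this]; ring
      have hz : Filter.Tendsto (fun n => ENNReal.ofReal 32 * D *
          ∫⁻ x, ‖pd i χ (r n • x) * W i x‖ₑ ^ 2) Filter.atTop (nhds 0) := by
        have h := ENNReal.Tendsto.const_mul (a := ENNReal.ofReal 32 * D) (htail i)
          (Or.inr (ENNReal.mul_ne_top (by simp) hDfin))
        simpa using h
      have h2 := tendsto_of_tendsto_of_tendsto_of_le_of_le tendsto_const_nhds hz
        (fun _ => zero_le) hbound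
      simp only [← ofReal_sq_eq_enorm] at h2
      have h3 := (ENNReal.tendsto_toReal ENNReal.zero_ne_top).comp h2
      have h4 : Filter.Tendsto (fun n =>
          (∫ x, (P x - c n) * (r n * (pd i χ (r n • x) * W i x))) ^ 2)
          Filter.atTop (nhds 0) := by
        refine h3.congr fun n => ?_
        simp [ENNReal.toReal_ofReal (sq_nonneg _)]
      have h5 := h4.sqrt
      simp only [Real.sqrt_sq_eq_abs, Real.sqrt_zero] at h5
      exact (tendsto_zero_iff_abs_tendsto_zero _).2 h5
    have := (tendsto_finsetSum Finset.univ fun i _ => hterm i).neg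
    simp only [Finset.sum_const_zero, neg_zero] at this
    exact this.congr fun n => (hident n (c n)).symm
  exact tendsto_nhds_unique hlim1 hlim2

/-- The energy estimate `‖∇P‖ ≤ ‖V‖` for `ΔP = div V`. The equation is stated through the partial
derivatives `W' i = ∂ᵢ (∂ᵢP - Vᵢ)`, so that `V` need only be differentiable in these directions. -/
lemma sum_sqL2_pd_le {P : ℝ × ℝ → ℝ} (hP : ContDiff ℝ 1 P) {V W' : Fin 2 → ℝ × ℝ → ℝ}
    (hVc : ∀ i, Continuous (V i)) (hW'c : ∀ i, Continuous (W' i))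
    (hW : ∀ i x, HasLineDerivAt ℝ (fun x => pd i P x - V i x) (W' i x) x (e i))
    (hdiv : ∀ x, ∑ i, W' i x = 0)
    (hP2 : ∀ i, sqL2 (pd i P) < ∞) (hV2 : ∀ i, sqL2 (V i) < ∞) :
    ∑ i, sqL2 (pd i P) ≤ ∑ i, sqL2 (V i) := by
  have hpc := fun i => continuous_pd hP i
  have mP := fun i => memLp_two_of_sqL2 (hpc i) (hP2 i)
  have mV := fun i => memLp_two_of_sqL2 (hVc i) (hV2 i)
  have mW := fun i => (mP i).sub (mV i)
  have horth := integral_grad_mul_eq_zero hP (W := fun i x => pd i P x - V i x)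
    (fun i => (hpc i).sub (hVc i)) hW'c hW hdiv hP2 (fun i => by
      have h := sqL2_eq_ofReal (mW i)
      exact lt_of_eq_of_lt h ENNReal.ofReal_lt_top)
  simp only [sqL2_eq_ofReal (mP _), sqL2_eq_ofReal (mV _)]
  rw [← ENNReal.ofReal_sum_of_nonneg (fun i _ => integral_nonneg fun x => sq_nonneg _),
    ← ENNReal.ofReal_sum_of_nonneg (fun i _ => integral_nonneg fun x => sq_nonneg _)]
  refine ENNReal.ofReal_le_ofReal ?_
  have hi : ∀ i, Integrable fun x => pd i P x * (pd i P x - V i x) := fun i =>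
    (mP i).integrable_mul (mW i)
  rw [integral_finsetSum _ fun i _ => hi i] at horth
  -- `|V|² - |∇P|² + 2 ∇P · (∇P - V) = |∇P - V|²` pointwise
  have h : ∀ i, ∫ x, pd i P x ^ 2 ≤
      (∫ x, V i x ^ 2) + 2 * ∫ x, pd i P x * (pd i P x - V i x) := by
    intro i
    rw [← integral_const_mul, ← integral_add (mV i).integrable_sq
      ((hi i).const_mul 2)]
    refine integral_mono (mP i).integrable_sq ((mV i).integrable_sq.add
      ((hi i).const_mul 2)) fun x => ?_
    nlinarith [sq_nonneg (pd i P x - V i x)]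
  refine (Finset.sum_le_sum fun i _ => h i).trans ?_
  rw [Finset.sum_add_distrib, ← Finset.mul_sum]
  rw [horth]; simp

end MHD

namespace MHD

/-- The second derivative estimate `‖∂₁²P‖ ≤ ‖ΔP‖`. The energy estimate is applied to the
difference quotients of `P` in the direction `x₁`, whose Laplacian is the `∂₁` derivative of an
average of `ΔP`; this needs no third derivatives of `P`. -/
lemma sqL2_pd_zero_pd_zero_le {P : ℝ × ℝ → ℝ} (hP : ContDiff ℝ 1 P)
    (hp : ∀ i, ContDiff ℝ 1 (pd i P)) (hP2 : ∀ i, sqL2 (pd i P) < ∞) (hF2 : sqL2 (lap P) < ∞) :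
    sqL2 (pd 0 (pd 0 P)) ≤ sqL2 (lap P) := by
  have hpp := fun i => continuous_pd (hp i) i
  have hFc : Continuous (lap P) := continuous_finsetSum _ fun i _ => hpp i
  have hFm := hFc.measurable
  have hshift : ∀ (h : ℝ) (x : ℝ × ℝ), HasFDerivAt (fun x : ℝ × ℝ => x + h • e 0)
      (ContinuousLinearMap.id ℝ (ℝ × ℝ)) x := fun h x => (hasFDerivAt_id x).add_const _
  have hshiftpd : ∀ (h : ℝ) {f : ℝ × ℝ → ℝ}, ContDiff ℝ 1 f → ∀ (j : Fin 2) (x : ℝ × ℝ),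
      pd j (fun x => f (x + h • e 0)) x = pd j f (x + h • e 0) := by
    intro h f hf j x
    have := ((hf.differentiable one_ne_zero (x + h • e 0)).hasFDerivAt.comp x (hshift h x)).fderiv
    simp only [pd]
    change fderiv ℝ (f ∘ fun x => x + h • e 0) x (e j) = _
    rw [this]; simp
  have hsm : ∀ (h : ℝ) {f : ℝ × ℝ → ℝ}, ContDiff ℝ 1 f →
      ContDiff ℝ 1 fun x => f (x + h • e 0) := fun h f hf =>
    hf.comp (contDiff_id.add contDiff_const)
  -- the difference quotients
  let δ : ℝ → (ℝ × ℝ → ℝ) → ℝ × ℝ → ℝ := fun h f x => h⁻¹ * (f (x + h • e 0) - f x)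
  have hδ : ∀ h {f : ℝ × ℝ → ℝ}, ContDiff ℝ 1 f → ContDiff ℝ 1 (δ h f) := fun h f hf =>
    contDiff_const.mul ((hsm h hf).sub hf)
  have hδpd : ∀ h {f : ℝ × ℝ → ℝ}, ContDiff ℝ 1 f → ∀ (j : Fin 2), pd j (δ h f) = δ h (pd j f) := by
    intro h f hf j
    funext x
    have h1 := (hsm h hf).differentiable one_ne_zero x
    have h2 := hf.differentiable one_ne_zero x
    refine (pd_const_mul (h1.sub h2) h⁻¹ j).trans ?_
    rw [show pd j ((fun x => f (x + h • e 0)) - f) x = _ from pd_sub h1 h2 j, hshiftpd h hf]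
  have hδ2 : ∀ h {f : ℝ × ℝ → ℝ}, Continuous f → sqL2 f < ∞ → sqL2 (δ h f) < ∞ := by
    intro h f hf h2
    have m := memLp_two_of_sqL2 hf h2
    have m' : MemLp (fun x => f (x + h • e 0)) 2 :=
      m.comp_measurePreserving (measurePreserving_add_right volume (h • e 0))
    have := sqL2_eq_ofReal ((m'.sub m).const_mul h⁻¹)
    exact lt_of_eq_of_lt this ENNReal.ofReal_lt_top
  have key : ∀ h : ℝ, 0 < h → sqL2 (δ h (pd 0 P)) ≤ sqL2 (lap P) := by
    intro h hh
    -- the average of the Laplacian over a segment of length `h`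
    let V0 : ℝ × ℝ → ℝ := fun x => h⁻¹ * ∫ s in 0..h, lap P (x + s • e 0)
    have hV0c : Continuous V0 := by
      refine continuous_const.mul
        (intervalIntegral.continuous_parametric_intervalIntegral_of_continuous' ?_ 0 h)
      exact hFc.comp (by fun_prop)
    have hV0d : ∀ x, HasLineDerivAt ℝ V0 (δ h (lap P) x) x (e 0) := by
      intro x
      have hcont : Continuous fun s : ℝ => lap P (x + s • e 0) := hFc.comp (by fun_prop)
      have hrepr : ∀ t, V0 (x + t • e 0) = h⁻¹ * ((∫ s in 0..(t + h), lap P (x + s • e 0))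
          - ∫ s in 0..t, lap P (x + s • e 0)) := by
        intro t
        have h1 := intervalIntegral.integral_comp_add_right (a := 0) (b := h)
          (fun s => lap P (x + s • e 0)) t
        rw [intervalIntegral.integral_interval_sub_left (hcont.intervalIntegrable _ _)
          (hcont.intervalIntegrable _ _), zero_add, add_comm h t] at *
        rw [← h1]
        simp only [V0]
        congr 2; funext s
        congr 1
        module
      have hd : ∀ t : ℝ, HasDerivAt (fun t => ∫ s in 0..t, lap P (x + s • e 0))
          (lap P (x + t • e 0)) t := fun t =>
        intervalIntegral.integral_hasDerivAt_right (hcont.intervalIntegrable _ _)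
          (hcont.stronglyMeasurableAtFilter _ _) hcont.continuousAt
      have hd1 := ((hd (0 + h)).comp_add_const 0 h).sub (hd 0)
      have hd2 := hd1.const_mul h⁻¹
      rw [zero_add, zero_smul, add_zero] at hd2
      unfold HasLineDerivAt
      rw [show (fun t : ℝ => V0 (x + t • e 0)) = _ from funext hrepr]
      exact hd2
    have hV02 : sqL2 V0 ≤ sqL2 (lap P) := by
      calc sqL2 V0 ≤ ∫⁻ x, ENNReal.ofReal h⁻¹ * ∫⁻ s in Ioc 0 h, ‖lap P (x + s • e 0)‖ₑ ^ 2 := by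
            rw [sqL2_eq]
            refine lintegral_mono fun x => ?_
            have hcont : Continuous fun s : ℝ => lap P (x + s • e 0) := hFc.comp (by fun_prop)
            have h1 : ‖∫ s in 0..h, lap P (x + s • e 0)‖ₑ ^ 2 ≤
                ENNReal.ofReal h * ∫⁻ s in Ioc 0 h, ‖lap P (x + s • e 0)‖ₑ ^ 2 := by
              rw [intervalIntegral.integral_of_le hh.le]
              refine (pow_le_pow_left' (enorm_integral_le_lintegral_enorm _) 2).trans ?_
              have := sq_lintegral_mul_le (μ := volume.restrict (Ioc 0 h)) (f := fun _ => (1:ℝ))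
                (by fun_prop) hcont.aemeasurable
              simpa using this
            simp only [V0, enorm_mul, mul_pow]
            rw [← ofReal_sq_eq_enorm h⁻¹]
            refine (mul_le_mul' le_rfl h1).trans (le_of_eq ?_)
            rw [← mul_assoc, ← ENNReal.ofReal_mul (by positivity)]
            congr 2
            field_simp
        _ = ENNReal.ofReal h⁻¹ * ∫⁻ s in Ioc 0 h, sqL2 (lap P) := by
            rw [lintegral_const_mul' _ _ ENNReal.ofReal_ne_top, lintegral_lintegral_swap]
            · congr 2; funext s
              rw [sqL2_eq]
              exact lintegral_add_right_eq_self (fun x => ‖lap P x‖ₑ ^ 2) (s • e 0)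
            · refine Measurable.aemeasurable ?_
              have : Continuous fun z : (ℝ × ℝ) × ℝ => lap P (z.1 + z.2 • e 0) :=
                hFc.comp (by fun_prop)
              exact this.measurable.enorm.pow_const 2
        _ = sqL2 (lap P) := by
            rw [setLIntegral_const, Real.volume_Ioc, sub_zero, mul_left_comm,
              ← ENNReal.ofReal_mul (by positivity), inv_mul_cancel₀ hh.ne', ENNReal.ofReal_one,
              mul_one]
    have hQ := hδ h hP
    let V : Fin 2 → ℝ × ℝ → ℝ := ![V0, fun _ => 0]
    let W' : Fin 2 → ℝ × ℝ → ℝ :=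
      ![fun x => δ h (pd 0 (pd 0 P)) x - δ h (lap P) x, δ h (pd 1 (pd 1 P))]
    have hδc : ∀ {f : ℝ × ℝ → ℝ}, Continuous f → Continuous (δ h f) := fun hf =>
      continuous_const.mul ((hf.comp (by fun_prop)).sub hf)
    have hmain := sum_sqL2_pd_le hQ (V := V) (W' := W') ?_ ?_ ?_ ?_ ?_ ?_
    · rw [Fin.sum_univ_two, Fin.sum_univ_two] at hmain
      have hV1 : sqL2 (V 1) = 0 := by simp [V, sqL2]
      rw [hV1, add_zero, hδpd h hP] at hmain
      exact le_self_add.trans (hmain.trans hV02)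
    · intro i; fin_cases i
      · exact hV0c
      · exact continuous_const
    · intro i; fin_cases i
      · exact (hδc (hpp 0)).sub (hδc hFc)
      · exact hδc (hpp 1)
    · intro i x
      have hl : ∀ i, HasLineDerivAt ℝ (pd i (δ h P)) (δ h (pd i (pd i P)) x) x (e i) := by
        intro i
        rw [hδpd h hP, ← hδpd h (hp i)]
        exact ((hδ h (hp i)).differentiable one_ne_zero x).hasFDerivAt.hasLineDerivAt (e i)
      fin_cases i
      · exact HasDerivAt.sub (hl 0) (hV0d x)
      · simpa [V, W'] using hl 1
    · intro x
      simp only [Fin.sum_univ_two, W', Matrix.cons_val_zero, Matrix.cons_val_one, δ, lap]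
      ring
    · intro i
      rw [hδpd h hP]
      exact hδ2 h (hp i).continuous (hP2 i)
    · intro i; fin_cases i
      · exact hV02.trans_lt hF2
      · simp [V, sqL2]
  -- let `h → 0` and apply Fatou's lemma
  let r : ℕ → ℝ := fun n => 1 / ((n : ℝ) + 1)
  have hr : ∀ n, 0 < r n := fun n => by positivity
  have hlim : ∀ x, Filter.Tendsto (fun n => ‖δ (r n) (pd 0 P) x‖ₑ ^ 2) Filter.atTop
      (nhds (‖pd 0 (pd 0 P) x‖ₑ ^ 2)) := by
    intro x
    have hl : HasLineDerivAt ℝ (pd 0 P) (pd 0 (pd 0 P) x) x (e 0) :=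
      ((hp 0).differentiable one_ne_zero x).hasFDerivAt.hasLineDerivAt (e 0)
    have h1 := hl.tendsto_slope_zero_right.comp (tendsto_nhdsWithin_iff.2
      ⟨tendsto_one_div_add_atTop_nhds_zero_nat (𝕜 := ℝ), Filter.Eventually.of_forall hr⟩)
    have h2 : Filter.Tendsto (fun n => δ (r n) (pd 0 P) x) Filter.atTop
        (nhds (pd 0 (pd 0 P) x)) := by
      simpa [Function.comp_def, δ, r] using h1
    exact ((ENNReal.continuous_pow 2).tendsto _).comp h2.enorm
  have hmeas : ∀ n, Measurable fun x => ‖δ (r n) (pd 0 P) x‖ₑ ^ 2 := fun n =>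
    ((hδ (r n) (hp 0)).continuous.measurable.enorm).pow_const 2
  rw [sqL2_eq (pd 0 (pd 0 P))]
  calc ∫⁻ x, ‖pd 0 (pd 0 P) x‖ₑ ^ 2
      = ∫⁻ x, Filter.liminf (fun n => ‖δ (r n) (pd 0 P) x‖ₑ ^ 2) Filter.atTop := by
        congr 1; funext x; exact (hlim x).liminf_eq.symm
    _ ≤ Filter.liminf (fun n => ∫⁻ x, ‖δ (r n) (pd 0 P) x‖ₑ ^ 2) Filter.atTop :=
        lintegral_liminf_le hmeas
    _ ≤ sqL2 (lap P) := by
        refine Filter.liminf_le_of_le (by isBoundedDefault) fun b hb => ?_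
        obtain ⟨n, hn⟩ := hb.exists
        exact hn.trans ((sqL2_eq _).symm.le.trans (key (r n) (hr n)))

end MHD

namespace MHD

/-! ### Estimates at a fixed time -/

/-- A scalar field on the plane whose `H²` norm is at most `μ` (up to constants), and whose
`∂₂` derivative has `H¹` norm at most `κ`. In the argument `μ` is bounded in time, while `κ` is
only square integrable in time: a factor `κ` is a gain. -/
structure Controlled (μ κ : ℝ≥0) (z : ℝ × ℝ → ℝ) : Prop where
  smooth : ContDiff ℝ 2 z
  bound : sqL2 z ≤ μ ^ 2
  bound_pd : ∀ i, sqL2 (pd i z) ≤ μ ^ 2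
  gain : sqL2 (pd 1 z) ≤ κ ^ 2
  gain_pd : ∀ i, sqL2 (pd i (pd 1 z)) ≤ κ ^ 2

namespace Controlled

variable {μ κ : ℝ≥0} {z w : ℝ × ℝ → ℝ}

lemma contDiff_one (h : Controlled μ κ z) : ContDiff ℝ 1 z := h.smooth.of_le (by norm_num)

lemma contDiff_pd (h : Controlled μ κ z) (j : Fin 2) : ContDiff ℝ 1 (pd j z) :=
  MHD.contDiff_pd (n := 1) h.smooth j

lemma lineSq_le (h : Controlled μ κ z) (a : ℝ) : lineSq z a ≤ 2 * μ * μ :=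
  MHD.lineSq_le h.contDiff_one h.bound (h.bound_pd 0) a

lemma lineSq_pd_le (h : Controlled μ κ z) (a : ℝ) : lineSq (pd 1 z) a ≤ 2 * κ * κ :=
  MHD.lineSq_le (h.contDiff_pd 1) h.gain (h.gain_pd 0) a

/-- The uniform bound gains `κ^{1/2}`. -/
lemma enorm_sq_le (h : Controlled μ κ z) (x : ℝ × ℝ) : ‖z x‖ₑ ^ 2 ≤ 4 * μ * κ := by
  have h1 := h.lineSq_le x.1
  have h2 := h.lineSq_pd_le x.1
  rw [← ENNReal.coe_ofNat, ← ENNReal.coe_mul, ← ENNReal.coe_mul] at h1 h2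
  have h3 := enorm_sq_le_of_lineSq_le h.contDiff_one h1 h2 x.2
  rw [← ENNReal.pow_le_pow_left_iff two_ne_zero]
  refine h3.trans (le_of_eq ?_)
  push_cast
  ring

lemma sqL2_mul_pd_le (h : Controlled μ κ z) (h' : Controlled μ κ w) :
    sqL2 (fun x => z x * pd 1 w x) ≤ 4 * (μ * κ ^ 3) := by
  refine (sqL2_mul_le h.contDiff_one (h'.contDiff_pd 1) h.bound h.gain h'.gain
    (h'.gain_pd 0)).trans (le_of_eq ?_)
  ring

lemma sqL2_pd_mul_pd_le (h : Controlled μ κ z) (h' : Controlled μ κ w) (i : Fin 2) :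
    sqL2 (fun x => pd i z x * pd 1 w x) ≤ 4 * (μ * κ ^ 3) := by
  refine (sqL2_mul_le (h.contDiff_pd i) (h'.contDiff_pd 1) (h.bound_pd i) (k := κ) ?_ h'.gain
    (h'.gain_pd 0)).trans (le_of_eq ?_)
  · rw [pd_comm h.smooth]; exact h.gain_pd i
  · ring

end Controlled

lemma sqL2_add_le {f g : ℝ × ℝ → ℝ} (hf : Continuous f) :
    sqL2 (fun x => f x + g x) ≤ 2 * sqL2 f + 2 * sqL2 g := by
  have := hf.measurable
  simp only [sqL2_eq]
  rw [← lintegral_const_mul' _ _ (by simp), ← lintegral_const_mul' _ _ (by simp),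
    ← lintegral_add_left (by fun_prop)]
  exact lintegral_mono fun x => enorm_add_sq_le _ _

lemma sqL2_const_mul (c : ℝ) (f : ℝ × ℝ → ℝ) : sqL2 (fun x => c * f x) = ‖c‖ₑ ^ 2 * sqL2 f := by
  simp only [sqL2_eq, enorm_mul, mul_pow]
  exact lintegral_const_mul' _ _ (by simp)

lemma sqL2_two_mul_sub_le {f g : ℝ × ℝ → ℝ} (hf : Continuous f) :
    sqL2 (fun x => 2 * f x - 2 * g x) ≤ 8 * sqL2 f + 8 * sqL2 g := by
  have h := sqL2_add_le (f := fun x => 2 * f x) (g := fun x => -2 * g x) (by fun_prop)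
  rw [sqL2_const_mul, sqL2_const_mul] at h
  have h2 : ‖(2 : ℝ)‖ₑ ^ 2 = 4 := by rw [← ofReal_sq_eq_enorm]; norm_num
  rw [enorm_neg, h2] at h
  refine (le_of_eq ?_).trans (h.trans (le_of_eq (by ring)))
  congr 1; funext x; ring

lemma lineSq_add_le {f g : ℝ × ℝ → ℝ} (hf : Continuous f) {σ : ℝ} (hσ : ‖σ‖ₑ = 1) (a : ℝ) :
    lineSq (fun x => f x + σ * g x) a ≤ 2 * lineSq f a + 2 * lineSq g a := by
  have := hf.measurable
  simp only [lineSq]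
  rw [← lintegral_const_mul' _ _ (by simp), ← lintegral_const_mul' _ _ (by simp),
    ← lintegral_add_left (by fun_prop)]
  refine lintegral_mono fun y => ?_
  simpa [enorm_mul, hσ] using enorm_add_sq_le (f (a, y)) (σ * g (a, y))

lemma lineSq_neg (f : ℝ × ℝ → ℝ) (a : ℝ) : lineSq (fun x => -f x) a = lineSq f a := by
  simp [lineSq]

lemma lintegral_line_mul_le {f g : ℝ × ℝ → ℝ} (hf : Continuous f) (hg : Continuous g) {a : ℝ}
    {A B C : ℝ≥0∞} (hA : lineSq f a ≤ A) (hB : lineSq g a ≤ B) (hC : A * B = C ^ 2) :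
    ∫⁻ y, ‖f (a, y) * g (a, y)‖ₑ ≤ C := by
  rw [← ENNReal.pow_le_pow_left_iff two_ne_zero, ← hC]
  refine (sq_lintegral_mul_le ?_ ?_).trans (mul_le_mul' hA hB)
  · exact (hf.comp (by fun_prop)).aemeasurable
  · exact (hg.comp (by fun_prop)).aemeasurable

lemma integrable_line_mul {f g : ℝ × ℝ → ℝ} (hf : Continuous f) (hg : Continuous g) {a : ℝ}
    (h : ∫⁻ y, ‖f (a, y) * g (a, y)‖ₑ < ∞) : Integrable fun y => f (a, y) * g (a, y) :=
  ⟨((hf.mul hg).comp (by fun_prop : Continuous fun y : ℝ => (a, y))).aestronglyMeasurable, h⟩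

/-- Integration by parts on a vertical half-line. -/
lemma integral_Iic_mul_pd {f g : ℝ × ℝ → ℝ} (hf : ContDiff ℝ 1 f) (hg : ContDiff ℝ 1 g) {a c : ℝ}
    (h0 : Integrable fun y => f (a, y) * g (a, y))
    (h1 : Integrable fun y => f (a, y) * pd 1 g (a, y))
    (h2 : Integrable fun y => pd 1 f (a, y) * g (a, y)) :
    ∫ y in Iic c, f (a, y) * pd 1 g (a, y) =
      f (a, c) * g (a, c) - ∫ y in Iic c, pd 1 f (a, y) * g (a, y) := by
  have hd : ∀ y, HasDerivAt (fun y => f (a, y) * g (a, y))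
      (pd 1 f (a, y) * g (a, y) + f (a, y) * pd 1 g (a, y)) y := fun y =>
    (hasDerivAt_snd hf a y).mul (hasDerivAt_snd hg a y)
  have hi : IntegrableOn (fun y => pd 1 f (a, y) * g (a, y) + f (a, y) * pd 1 g (a, y)) (Iic c) :=
    (h2.add h1).integrableOn
  have ht := tendsto_zero_of_hasDerivAt_of_integrableOn_Iic (fun y _ => hd y) hi h0.integrableOn
  have := integral_Iic_of_hasDerivAt_of_tendsto (hd c).continuousAt.continuousWithinAt
    (fun y _ => hd y) hi ht
  rw [integral_add h2.integrableOn h1.integrableOn, sub_zero] at this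
  rw [← this]; ring

/-- The pressure gradient gains `κ^{3/2}`. The quadratic terms have the form `div V` with
`V = 2 (b₂ ∂₂b - u₂ ∂₂u)`, since both fields are divergence free; the product estimate bounds both
`V` and `div V` in `L²`, and the trace inequality bounds `∂₁P` on vertical lines. -/
lemma lineSq_pressure_le {μ κ : ℝ≥0} {u b : Fin 2 → ℝ × ℝ → ℝ} {P : ℝ × ℝ → ℝ}
    (hu : ∀ i, Controlled μ κ (u i)) (hb : ∀ i, Controlled μ κ (b i))
    (du : ∀ x, ∑ j, pd j (u j) x = 0) (db : ∀ x, ∑ j, pd j (b j) x = 0)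
    (hP : ContDiff ℝ 1 P) (hp : ∀ i, ContDiff ℝ 1 (pd i P)) (hP2 : ∀ i, sqL2 (pd i P) < ∞)
    (hlap : ∀ x, lap P x = 2 * (pd 1 (b 1) x * pd 1 (b 1) x + pd 0 (b 1) x * pd 1 (b 0) x)
      - 2 * (pd 1 (u 1) x * pd 1 (u 1) x + pd 0 (u 1) x * pd 1 (u 0) x)) (a : ℝ) :
    lineSq (pd 0 P) a ≤ 512 * (μ * κ ^ 3) := by
  have hq : ∀ {z : Fin 2 → ℝ × ℝ → ℝ}, (∀ i, Controlled μ κ (z i)) → ∀ i,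
      ContDiff ℝ 1 fun x => z 1 x * pd 1 (z i) x := fun hz i =>
    (hz 1).contDiff_one.mul ((hz i).contDiff_pd 1)
  have hqdiv : ∀ {z : Fin 2 → ℝ × ℝ → ℝ}, (∀ i, Controlled μ κ (z i)) →
      (∀ x, ∑ j, pd j (z j) x = 0) → ∀ x, ∑ i, pd i (fun x => z 1 x * pd 1 (z i) x) x =
        pd 1 (z 1) x * pd 1 (z 1) x + pd 0 (z 1) x * pd 1 (z 0) x := by
    intro z hz dz x
    have h1 : ∀ i, pd i (fun x => z 1 x * pd 1 (z i) x) x =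
        z 1 x * pd 1 (pd i (z i)) x + pd i (z 1) x * pd 1 (z i) x := fun i => by
      rw [pd_mul ((hz 1).contDiff_one.differentiable one_ne_zero x)
        (((hz i).contDiff_pd 1).differentiable one_ne_zero x), pd_comm (hz i).smooth]
    have h2 : pd 1 (pd 0 (z 0)) x + pd 1 (pd 1 (z 1)) x = 0 := by
      rw [← pd_add (((hz 0).contDiff_pd 0).differentiable one_ne_zero x)
        (((hz 1).contDiff_pd 1).differentiable one_ne_zero x)]
      have : (fun x => pd 0 (z 0) x + pd 1 (z 1) x) = fun _ => 0 := by
        funext x; simpa [Fin.sum_univ_two] using dz x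
      rw [this]; simp [pd]
    rw [Fin.sum_univ_two, h1, h1]
    linear_combination z 1 x * h2
  let V : Fin 2 → ℝ × ℝ → ℝ := fun i x =>
    2 * (b 1 x * pd 1 (b i) x) - 2 * (u 1 x * pd 1 (u i) x)
  have hV : ∀ i, ContDiff ℝ 1 (V i) := fun i =>
    (contDiff_const.mul (hq hb i)).sub (contDiff_const.mul (hq hu i))
  have hVpd : ∀ i x, pd i (V i) x = 2 * pd i (fun x => b 1 x * pd 1 (b i) x) x
      - 2 * pd i (fun x => u 1 x * pd 1 (u i) x) x := by
    intro i x
    have e1 := (hq hb i).differentiable one_ne_zero x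
    have e2 := (hq hu i).differentiable one_ne_zero x
    rw [← pd_const_mul e1, ← pd_const_mul e2]
    exact pd_sub (e1.const_mul 2) (e2.const_mul 2) i
  have hV2 : ∀ i, sqL2 (V i) ≤ 64 * (μ * κ ^ 3) := by
    intro i
    refine (sqL2_two_mul_sub_le (hq hb i).continuous).trans ?_
    refine (add_le_add (mul_le_mul' le_rfl ((hb 1).sqL2_mul_pd_le (hb i)))
      (mul_le_mul' le_rfl ((hu 1).sqL2_mul_pd_le (hu i)))).trans (le_of_eq ?_)
    ring
  have hquad : ∀ {z : Fin 2 → ℝ × ℝ → ℝ}, (∀ i, Controlled μ κ (z i)) →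
      sqL2 (fun x => pd 1 (z 1) x * pd 1 (z 1) x + pd 0 (z 1) x * pd 1 (z 0) x) ≤
        16 * (μ * κ ^ 3) := by
    intro z hz
    have hc := ((hz 1).contDiff_pd 1).continuous
    refine (sqL2_add_le (hc.mul hc)).trans ?_
    refine (add_le_add (mul_le_mul' le_rfl ((hz 1).sqL2_pd_mul_pd_le (hz 1) 1))
      (mul_le_mul' le_rfl ((hz 1).sqL2_pd_mul_pd_le (hz 0) 0))).trans (le_of_eq ?_)
    ring
  have hF2 : sqL2 (lap P) ≤ 256 * (μ * κ ^ 3) := by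
    rw [show lap P = _ from funext hlap]
    have hc : ∀ i j, Continuous (pd i (b j)) := fun i j => ((hb j).contDiff_pd i).continuous
    refine (sqL2_two_mul_sub_le (((hc 1 1).mul (hc 1 1)).add ((hc 0 1).mul (hc 1 0)))).trans ?_
    refine (add_le_add (mul_le_mul' le_rfl (hquad hb))
      (mul_le_mul' le_rfl (hquad hu))).trans (le_of_eq ?_)
    ring
  have hfin : (64 * (μ * κ ^ 3) : ℝ≥0∞) < ∞ := by finiteness
  have h1 : sqL2 (pd 0 P) ≤ 256 * (μ * κ ^ 3) := by
    have hen := sum_sqL2_pd_le hP (V := V) (W' := fun i x => pd i (pd i P) x - pd i (V i) x)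
      (fun i => (hV i).continuous)
      (fun i => (continuous_pd (hp i) i).sub (continuous_pd (hV i) i))
      (fun i x => ((((hp i).sub (hV i)).differentiable one_ne_zero x).hasFDerivAt.hasLineDerivAt
        (e i)).congr_deriv (pd_sub ((hp i).differentiable one_ne_zero x)
          ((hV i).differentiable one_ne_zero x) i))
      (fun x => ?_) hP2 (fun i => (hV2 i).trans_lt hfin)
    · rw [Fin.sum_univ_two, Fin.sum_univ_two] at hen
      refine le_self_add.trans (hen.trans ((add_le_add (hV2 0) (hV2 1)).trans ?_))
      rw [← add_mul]
      gcongr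
      norm_num
    · rw [Finset.sum_sub_distrib]
      simp only [hVpd]
      rw [Finset.sum_sub_distrib, ← Finset.mul_sum, ← Finset.mul_sum, hqdiv hb db, hqdiv hu du,
        ← hlap]
      simp [lap]
  have h2 : sqL2 (pd 0 (pd 0 P)) ≤ 256 * (μ * κ ^ 3) :=
    (sqL2_pd_zero_pd_zero_le hP hp hP2 (hF2.trans_lt (by finiteness))).trans hF2
  set s : ℝ≥0 := 16 * NNReal.sqrt (μ * κ ^ 3) with hs
  have hs2 : (256 * (μ * κ ^ 3) : ℝ≥0∞) = (s : ℝ≥0∞) ^ 2 := by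
    norm_cast
    rw [hs, mul_pow, NNReal.sq_sqrt]; norm_num
  rw [hs2] at h1 h2
  refine (lineSq_le (hp 0) h1 h2 a).trans (le_of_eq ?_)
  rw [mul_assoc, ← pow_two, ← hs2, ← mul_assoc]
  norm_num

end MHD

namespace MHD

/-- The Elsässer variable `u₁ + σ b₁` of a pair of vector fields on the plane. -/
def els (σ : ℝ) (u b : Fin 2 → ℝ × ℝ → ℝ) (x : ℝ × ℝ) : ℝ := u 0 x + σ * b 0 x

/-- The vorticity with the sign for which `Δu₁ = ∂₂ φ` when `u` is divergence free. -/
noncomputable def vort (u : Fin 2 → ℝ × ℝ → ℝ) (x : ℝ × ℝ) : ℝ := pd 1 (u 0) x - pd 0 (u 1) x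

/-- The quadratic part `∂₁P + (u - σ b) · ∇Ω` of the equation for the Elsässer variable `Ω`. -/
noncomputable def quadPart (σ : ℝ) (u b : Fin 2 → ℝ × ℝ → ℝ) (P : ℝ × ℝ → ℝ) (x : ℝ × ℝ) : ℝ :=
  pd 0 P x + ∑ j, (u j x - σ * b j x) * pd j (els σ u b) x

/-- The right-hand side of the equation `∂ₜΩ = Δu₁ - ∂₁P - (u - σ b) · ∇Ω + σ ∂₂Ω`. -/
noncomputable def elsRhs (σ : ℝ) (u b : Fin 2 → ℝ × ℝ → ℝ) (P : ℝ × ℝ → ℝ) (x : ℝ × ℝ) : ℝ :=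
  pd 1 (vort u) x - quadPart σ u b P x + σ * pd 1 (els σ u b) x

/-- The spatial data of a solution at a fixed time, with the bounds available there: `μ` bounds the
`H²` norms of `u` and `b`, and `κ` the `H²` norm of `∇u` and the `H¹` norm of `∂₂b`. -/
structure TimeSlice (μ κ : ℝ≥0) (u b : Fin 2 → ℝ × ℝ → ℝ) (P : ℝ × ℝ → ℝ) : Prop where
  smooth_u : ∀ i, ContDiff ℝ 3 (u i)
  ctrl_u : ∀ i, Controlled μ κ (u i)
  ctrl_b : ∀ i, Controlled μ κ (b i)
  gain_u : ∀ i j, sqL2 (pd j (u i)) ≤ κ ^ 2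
  gain_u' : ∀ i j k, sqL2 (pd k (pd j (u i))) ≤ κ ^ 2
  gain_u'' : ∀ i j k l, sqL2 (pd l (pd k (pd j (u i)))) ≤ κ ^ 2
  div_u : ∀ x, ∑ j, pd j (u j) x = 0
  div_b : ∀ x, ∑ j, pd j (b j) x = 0
  smooth_P : ContDiff ℝ 1 P
  smooth_pd_P : ∀ i, ContDiff ℝ 1 (pd i P)
  sqL2_pd_P : ∀ i, sqL2 (pd i P) < ∞
  lap_P : ∀ x, lap P x = 2 * (pd 1 (b 1) x * pd 1 (b 1) x + pd 0 (b 1) x * pd 1 (b 0) x)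
    - 2 * (pd 1 (u 1) x * pd 1 (u 1) x + pd 0 (u 1) x * pd 1 (u 0) x)

namespace TimeSlice

variable {μ κ : ℝ≥0} {u b : Fin 2 → ℝ × ℝ → ℝ} {P : ℝ × ℝ → ℝ} {σ : ℝ}

lemma contDiff_els (h : TimeSlice μ κ u b P) (σ : ℝ) : ContDiff ℝ 2 (els σ u b) :=
  (h.ctrl_u 0).smooth.add (contDiff_const.mul (h.ctrl_b 0).smooth)

lemma contDiff_one_els (h : TimeSlice μ κ u b P) (σ : ℝ) : ContDiff ℝ 1 (els σ u b) :=
  (h.contDiff_els σ).of_le (by norm_num)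

lemma pd_els (h : TimeSlice μ κ u b P) (σ : ℝ) (j : Fin 2) (x : ℝ × ℝ) :
    pd j (els σ u b) x = pd j (u 0) x + σ * pd j (b 0) x := by
  have h1 := (h.ctrl_u 0).contDiff_one.differentiable one_ne_zero x
  have h2 := (h.ctrl_b 0).contDiff_one.differentiable one_ne_zero x
  rw [← pd_const_mul h2]
  exact pd_add h1 (h2.const_mul σ) j

lemma contDiff_pd_u (h : TimeSlice μ κ u b P) (i j : Fin 2) : ContDiff ℝ 2 (pd j (u i)) :=
  contDiff_pd (n := 2) (h.smooth_u i) j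

lemma contDiff_vort (h : TimeSlice μ κ u b P) : ContDiff ℝ 2 (vort u) :=
  (h.contDiff_pd_u 0 1).sub (h.contDiff_pd_u 1 0)

lemma continuous_quadPart (h : TimeSlice μ κ u b P) (σ : ℝ) :
    Continuous (quadPart σ u b P) := by
  refine (continuous_pd h.smooth_P 0).add (continuous_finsetSum _ fun j _ => Continuous.mul ?_
    (continuous_pd (h.contDiff_one_els σ) j))
  exact (h.ctrl_u j).smooth.continuous.sub (continuous_const.mul (h.ctrl_b j).smooth.continuous)

lemma enorm_sign (hσ : σ = 1 ∨ σ = -1) : ‖σ‖ₑ = 1 := by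
  rcases hσ with rfl | rfl <;> simp

/-- On vertical lines the first component of a divergence-free field gains `κ`. -/
lemma lineSq_els_le (h : TimeSlice μ κ u b P) (hσ : σ = 1 ∨ σ = -1) (a : ℝ) :
    lineSq (els σ u b) a ≤ 8 * (μ * κ) := by
  have key : ∀ {z : Fin 2 → ℝ × ℝ → ℝ}, (∀ i, Controlled μ κ (z i)) →
      (∀ x, ∑ j, pd j (z j) x = 0) → lineSq (z 0) a ≤ 2 * μ * κ := by
    intro z hz dz
    refine lineSq_le (hz 0).contDiff_one (hz 0).bound ?_ a
    have : pd 0 (z 0) = fun x => (-1 : ℝ) * pd 1 (z 1) x := by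
      funext x; have := dz x; rw [Fin.sum_univ_two] at this; linarith
    rw [this, sqL2_const_mul]
    simpa using (hz 1).gain
  refine (lineSq_add_le (h.ctrl_u 0).smooth.continuous (enorm_sign hσ) a).trans ?_
  refine (add_le_add (mul_le_mul' le_rfl (key h.ctrl_u h.div_u))
    (mul_le_mul' le_rfl (key h.ctrl_b h.div_b))).trans (le_of_eq ?_)
  ring

lemma lineSq_els_le' (h : TimeSlice μ κ u b P) (hσ : σ = 1 ∨ σ = -1) (a : ℝ) :
    lineSq (els σ u b) a ≤ 8 * μ ^ 2 := by
  refine (lineSq_add_le (h.ctrl_u 0).smooth.continuous (enorm_sign hσ) a).trans ?_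
  refine (add_le_add (mul_le_mul' le_rfl ((h.ctrl_u 0).lineSq_le a))
    (mul_le_mul' le_rfl ((h.ctrl_b 0).lineSq_le a))).trans (le_of_eq ?_)
  ring

lemma lineSq_pd_els_le (h : TimeSlice μ κ u b P) (hσ : σ = 1 ∨ σ = -1) (j : Fin 2) (a : ℝ) :
    lineSq (pd j (els σ u b)) a ≤ 8 * κ ^ 2 := by
  have key : ∀ i, lineSq (fun x => pd 1 (u i) x + σ * pd 1 (b i) x) a ≤ 8 * κ ^ 2 := by
    intro i
    refine (lineSq_add_le ((h.ctrl_u i).contDiff_pd 1).continuous (enorm_sign hσ) a).trans ?_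
    refine (add_le_add (mul_le_mul' le_rfl ((h.ctrl_u i).lineSq_pd_le a))
      (mul_le_mul' le_rfl ((h.ctrl_b i).lineSq_pd_le a))).trans (le_of_eq ?_)
    ring
  rw [show pd j (els σ u b) = _ from funext (h.pd_els σ j)]
  fin_cases j
  · have : (fun x => pd 0 (u 0) x + σ * pd 0 (b 0) x) =
        fun x => -(pd 1 (u 1) x + σ * pd 1 (b 1) x) := by
      funext x
      have h1 := h.div_u x
      have h2 := h.div_b x
      rw [Fin.sum_univ_two] at h1 h2
      linear_combination h1 + σ * h2
    change lineSq (fun x => pd 0 (u 0) x + σ * pd 0 (b 0) x) a ≤ _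
    rw [this, lineSq_neg]
    exact key 1
  · exact key 0

lemma lineSq_vort_le (h : TimeSlice μ κ u b P) (a : ℝ) : lineSq (vort u) a ≤ 8 * κ ^ 2 := by
  have key : ∀ i j, lineSq (pd j (u i)) a ≤ 2 * κ * κ := fun i j =>
    lineSq_le ((h.contDiff_pd_u i j).of_le (by norm_num)) (h.gain_u i j) (h.gain_u' i j 0) a
  have h1 := lineSq_add_le (f := pd 1 (u 0)) (g := pd 0 (u 1)) (h.contDiff_pd_u 0 1).continuous
    (enorm_sign (Or.inr rfl)) a
  refine (le_of_eq ?_).trans (h1.trans ((add_le_add (mul_le_mul' le_rfl (key 0 1))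
    (mul_le_mul' le_rfl (key 1 0))).trans (le_of_eq (by ring))))
  congr 1; funext x; rw [vort]; ring

lemma lineSq_pd_vort_le (h : TimeSlice μ κ u b P) (a : ℝ) :
    lineSq (pd 1 (vort u)) a ≤ 8 * κ ^ 2 := by
  have key : ∀ i j k, lineSq (pd k (pd j (u i))) a ≤ 2 * κ * κ := fun i j k =>
    lineSq_le (contDiff_pd (n := 1) (h.contDiff_pd_u i j) k) (h.gain_u' i j k)
      (h.gain_u'' i j k 0) a
  have h1 := lineSq_add_le (f := pd 1 (pd 1 (u 0))) (g := pd 1 (pd 0 (u 1)))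
    (contDiff_pd (n := 1) (h.contDiff_pd_u 0 1) 1).continuous (enorm_sign (Or.inr rfl)) a
  refine (le_of_eq ?_).trans (h1.trans ((add_le_add (mul_le_mul' le_rfl (key 0 1 1))
    (mul_le_mul' le_rfl (key 1 0 1))).trans (le_of_eq (by ring))))
  congr 1; funext x
  have e1 := (h.contDiff_pd_u 0 1).differentiable two_ne_zero x
  have e2 := (h.contDiff_pd_u 1 0).differentiable two_ne_zero x
  refine (pd_sub e1 e2 1).trans ?_
  ring

/-- All four factors of the quadratic part gain: on each vertical line
`∫ |Ω (∂₁P + (u - σ b) · ∇Ω)| ≤ 128 μ κ²`. -/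
lemma lintegral_els_mul_quadPart_le (h : TimeSlice μ κ u b P) (hσ : σ = 1 ∨ σ = -1) (a : ℝ) :
    ∫⁻ y, ‖els σ u b (a, y) * quadPart σ u b P (a, y)‖ₑ ≤ 128 * (μ * κ ^ 2) := by
  set t := NNReal.sqrt (μ * κ) with ht
  have ht2 : (μ : ℝ≥0∞) * κ = (t : ℝ≥0∞) ^ 2 := by
    norm_cast; rw [ht, NNReal.sq_sqrt]
  have hΩc := (h.contDiff_els σ).continuous
  have hΩ := h.lineSq_els_le hσ a
  rw [ht2] at hΩ
  have hpc := continuous_pd h.smooth_P 0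
  have hP : ∫⁻ y, ‖els σ u b (a, y) * pd 0 P (a, y)‖ₑ ≤ 64 * (μ * κ ^ 2) := by
    refine lintegral_line_mul_le hΩc hpc hΩ (lineSq_pressure_le h.ctrl_u h.ctrl_b h.div_u h.div_b
      h.smooth_P h.smooth_pd_P h.sqL2_pd_P h.lap_P a) ?_
    rw [← ht2]; ring
  have hv : ∀ j, ∫⁻ y, ‖els σ u b (a, y) *
      ((u j (a, y) - σ * b j (a, y)) * pd j (els σ u b) (a, y))‖ₑ ≤ 32 * (μ * κ ^ 2) := by
    intro j
    have hdc := continuous_pd (h.contDiff_one_els σ) j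
    have h1 : ∫⁻ y, ‖els σ u b (a, y) * pd j (els σ u b) (a, y)‖ₑ ≤ 8 * (t * κ) := by
      refine lintegral_line_mul_le hΩc hdc hΩ (h.lineSq_pd_els_le hσ j a) ?_
      ring
    have h2 : ∀ y, ‖u j (a, y) - σ * b j (a, y)‖ₑ ≤ 4 * t := by
      intro y
      rw [← ENNReal.pow_le_pow_left_iff two_ne_zero]
      have h3 := enorm_add_sq_le (u j (a, y)) (-σ * b j (a, y))
      rw [neg_mul, ← sub_eq_add_neg] at h3
      refine h3.trans ?_
      rw [enorm_neg, enorm_mul, enorm_sign hσ, one_mul]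
      refine (add_le_add (mul_le_mul' le_rfl ((h.ctrl_u j).enorm_sq_le _))
        (mul_le_mul' le_rfl ((h.ctrl_b j).enorm_sq_le _))).trans (le_of_eq ?_)
      rw [mul_pow, ← ht2]; ring
    calc _ ≤ ∫⁻ y, (4 * t) * ‖els σ u b (a, y) * pd j (els σ u b) (a, y)‖ₑ := by
          refine lintegral_mono fun y => ?_
          rw [mul_left_comm, enorm_mul]
          gcongr
          exact h2 y
      _ ≤ (4 * t) * (8 * (t * κ)) := by
          rw [lintegral_const_mul' _ _ (by finiteness)]
          gcongr
      _ = 32 * (t ^ 2 * κ) := by ring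
      _ = _ := by rw [← ht2]; ring
  have hmeas : ∀ {f g : ℝ × ℝ → ℝ}, Continuous f → Continuous g →
      Measurable fun y : ℝ => ‖f (a, y) * g (a, y)‖ₑ := fun hf hg =>
    ((hf.mul hg).comp (by fun_prop : Continuous fun y : ℝ => (a, y))).measurable.enorm
  have hvc : Continuous fun x => (u 0 x - σ * b 0 x) * pd 0 (els σ u b) x :=
    ((h.ctrl_u 0).smooth.continuous.sub (continuous_const.mul
      (h.ctrl_b 0).smooth.continuous)).mul (continuous_pd (h.contDiff_one_els σ) 0)
  calc _ ≤ ∫⁻ y, (‖els σ u b (a, y) * pd 0 P (a, y)‖ₑ +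
        (‖els σ u b (a, y) * ((u 0 (a, y) - σ * b 0 (a, y)) * pd 0 (els σ u b) (a, y))‖ₑ
        + ‖els σ u b (a, y) * ((u 1 (a, y) - σ * b 1 (a, y)) * pd 1 (els σ u b) (a, y))‖ₑ)) := by
        refine lintegral_mono fun y => ?_
        rw [quadPart, Fin.sum_univ_two, mul_add, mul_add]
        exact (enorm_add_le _ _).trans (add_le_add le_rfl (enorm_add_le _ _))
    _ ≤ 64 * (μ * κ ^ 2) + (32 * (μ * κ ^ 2) + 32 * (μ * κ ^ 2)) := by
        rw [lintegral_add_left (hmeas hΩc hpc), lintegral_add_left (hmeas hΩc hvc)]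
        exact add_le_add hP (add_le_add (hv 0) (hv 1))
    _ = _ := by ring

lemma lintegral_els_mul_pd_els_le (h : TimeSlice μ κ u b P) (hσ : σ = 1 ∨ σ = -1) (a : ℝ) :
    ∫⁻ y, ‖els σ u b (a, y) * pd 1 (els σ u b) (a, y)‖ₑ ≤ 8 * (μ * κ) :=
  lintegral_line_mul_le (h.contDiff_els σ).continuous (continuous_pd (h.contDiff_one_els σ) 1)
    (h.lineSq_els_le' hσ a) (h.lineSq_pd_els_le hσ 1 a) (by ring)

lemma lintegral_els_mul_pd_vort_le (h : TimeSlice μ κ u b P) (hσ : σ = 1 ∨ σ = -1) (a : ℝ) :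
    ∫⁻ y, ‖els σ u b (a, y) * pd 1 (vort u) (a, y)‖ₑ ≤ 8 * (μ * κ) :=
  lintegral_line_mul_le (h.contDiff_els σ).continuous
    (continuous_pd (h.contDiff_vort.of_le (by norm_num)) 1)
    (h.lineSq_els_le' hσ a) (h.lineSq_pd_vort_le a) (by ring)

lemma lintegral_pd_els_mul_vort_le (h : TimeSlice μ κ u b P) (hσ : σ = 1 ∨ σ = -1) (a : ℝ) :
    ∫⁻ y, ‖pd 1 (els σ u b) (a, y) * vort u (a, y)‖ₑ ≤ 8 * κ ^ 2 :=
  lintegral_line_mul_le (continuous_pd (h.contDiff_one_els σ) 1) h.contDiff_vort.continuous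
    (h.lineSq_pd_els_le hσ 1 a) (h.lineSq_vort_le a) (by ring)

/-- A crude bound, which makes `∫ Ω ∂ₜΩ` on vertical lines integrable in time. -/
lemma lintegral_els_mul_elsRhs_le (h : TimeSlice μ κ u b P) (hσ : σ = 1 ∨ σ = -1) (a : ℝ) :
    ∫⁻ y, ‖els σ u b (a, y) * elsRhs σ u b P (a, y)‖ₑ ≤
      16 * (μ * κ) + 128 * (μ * κ ^ 2) := by
  have hmeas : ∀ {f g : ℝ × ℝ → ℝ}, Continuous f → Continuous g →
      Measurable fun y : ℝ => ‖f (a, y) * g (a, y)‖ₑ := fun hf hg =>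
    ((hf.mul hg).comp (by fun_prop : Continuous fun y : ℝ => (a, y))).measurable.enorm
  have hΩc := (h.contDiff_els σ).continuous
  calc _ ≤ ∫⁻ y, (‖els σ u b (a, y) * pd 1 (vort u) (a, y)‖ₑ +
        (‖els σ u b (a, y) * quadPart σ u b P (a, y)‖ₑ
        + ‖els σ u b (a, y) * pd 1 (els σ u b) (a, y)‖ₑ)) := by
        refine lintegral_mono fun y => ?_
        have : els σ u b (a, y) * elsRhs σ u b P (a, y) =
            els σ u b (a, y) * pd 1 (vort u) (a, y) + (-(els σ u b (a, y) *
            quadPart σ u b P (a, y)) + σ * (els σ u b (a, y) * pd 1 (els σ u b) (a, y))) := by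
          rw [elsRhs]; ring
        rw [this]
        refine (enorm_add_le _ _).trans (add_le_add le_rfl ((enorm_add_le _ _).trans ?_))
        rw [enorm_neg, enorm_mul σ, enorm_sign hσ, one_mul]
    _ ≤ 8 * (μ * κ) + (128 * (μ * κ ^ 2) + 8 * (μ * κ)) := by
        rw [lintegral_add_left (hmeas hΩc (continuous_pd (h.contDiff_vort.of_le (by norm_num)) 1)),
          lintegral_add_left (hmeas hΩc (h.continuous_quadPart σ))]
        exact add_le_add (h.lintegral_els_mul_pd_vort_le hσ a)
          (add_le_add (h.lintegral_els_mul_quadPart_le hσ a) (h.lintegral_els_mul_pd_els_le hσ a))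
    _ = _ := by ring

/-- The pointwise bound of `G = Ω² - σ ∂ₜ ∫_{-∞}^{x₂} Ω²`. The linear term `σ ∂₂Ω` of the equation
cancels `Ω²`, and the viscous term `Δu₁ = ∂₂φ` is integrated by parts. -/
lemma enorm_sq_sub_integral_le (h : TimeSlice μ κ u b P) (hσ : σ = 1 ∨ σ = -1) (x : ℝ × ℝ) :
    ‖els σ u b x ^ 2 - σ * ∫ y in Iic x.2, 2 * (els σ u b (x.1, y) * elsRhs σ u b P (x.1, y))‖ₑ ≤
      2 * ‖els σ u b x * vort u x‖ₑ + (16 + 256 * μ) * κ ^ 2 := by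
  obtain ⟨a, c⟩ := x
  have hΩ := h.contDiff_one_els σ
  have hφ : ContDiff ℝ 1 (vort u) := h.contDiff_vort.of_le (by norm_num)
  have hΩc := hΩ.continuous
  have hdΩc := continuous_pd hΩ 1
  have hφc := hφ.continuous
  have hdφc := continuous_pd hφ 1
  have iΩΩ : Integrable fun y => els σ u b (a, y) * els σ u b (a, y) := by
    refine integrable_line_mul hΩc hΩc (lt_of_le_of_lt (lintegral_line_mul_le hΩc hΩc
      (h.lineSq_els_le' hσ a) (h.lineSq_els_le' hσ a) (C := 8 * μ ^ 2) (by ring)) (by finiteness))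
  have iΩdΩ : Integrable fun y => els σ u b (a, y) * pd 1 (els σ u b) (a, y) :=
    integrable_line_mul hΩc hdΩc ((h.lintegral_els_mul_pd_els_le hσ a).trans_lt (by finiteness))
  have iΩφ : Integrable fun y => els σ u b (a, y) * vort u (a, y) := by
    refine integrable_line_mul hΩc hφc (lt_of_le_of_lt (lintegral_line_mul_le hΩc hφc
      (h.lineSq_els_le' hσ a) (h.lineSq_vort_le a) (C := 8 * (μ * κ)) (by ring)) (by finiteness))
  have iΩdφ : Integrable fun y => els σ u b (a, y) * pd 1 (vort u) (a, y) :=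
    integrable_line_mul hΩc hdφc ((h.lintegral_els_mul_pd_vort_le hσ a).trans_lt (by finiteness))
  have idΩφ : Integrable fun y => pd 1 (els σ u b) (a, y) * vort u (a, y) :=
    integrable_line_mul hdΩc hφc ((h.lintegral_pd_els_mul_vort_le hσ a).trans_lt (by finiteness))
  have iq : Integrable fun y => els σ u b (a, y) * quadPart σ u b P (a, y) :=
    integrable_line_mul hΩc (h.continuous_quadPart σ)
      ((h.lintegral_els_mul_quadPart_le hσ a).trans_lt (by finiteness))
  have hΩ2 : ∫ y in Iic c, 2 * (els σ u b (a, y) * pd 1 (els σ u b) (a, y)) =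
      els σ u b (a, c) ^ 2 := by
    have h1 := integral_Iic_mul_pd (c := c) hΩ hΩ iΩΩ iΩdΩ
      (by simpa only [mul_comm] using iΩdΩ)
    rw [integral_const_mul, two_mul]
    nth_rw 1 [h1]
    simp only [mul_comm (pd 1 (els σ u b) _)]
    ring
  have hφ2 := integral_Iic_mul_pd (c := c) hΩ hφ iΩφ iΩdφ idΩφ
  have hσ2 : σ * σ = 1 := by rcases hσ with rfl | rfl <;> norm_num
  have hsplit : ∫ y in Iic c, 2 * (els σ u b (a, y) * elsRhs σ u b P (a, y)) =
      2 * (els σ u b (a, c) * vort u (a, c)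
        - ∫ y in Iic c, pd 1 (els σ u b) (a, y) * vort u (a, y))
      - 2 * (∫ y in Iic c, els σ u b (a, y) * quadPart σ u b P (a, y))
      + σ * els σ u b (a, c) ^ 2 := by
    have i1 : Integrable fun y => 2 * (els σ u b (a, y) * pd 1 (vort u) (a, y))
        - 2 * (els σ u b (a, y) * quadPart σ u b P (a, y)) :=
      (iΩdφ.const_mul 2).sub (iq.const_mul 2)
    rw [← hφ2, ← hΩ2, ← integral_const_mul, ← integral_const_mul, ← integral_const_mul,
      ← integral_sub (iΩdφ.const_mul 2).integrableOn (iq.const_mul 2).integrableOn,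
      ← integral_add i1.integrableOn
        ((iΩdΩ.const_mul 2).const_mul σ).integrableOn]
    congr 1; funext y
    simp only [elsRhs]; ring
  have h2 : ‖(2 : ℝ)‖ₑ = 2 := by simp [Real.enorm_eq_ofReal]
  have hI1 : ‖∫ y in Iic c, pd 1 (els σ u b) (a, y) * vort u (a, y)‖ₑ ≤ 8 * κ ^ 2 :=
    (enorm_integral_le_lintegral_enorm _).trans ((setLIntegral_le_lintegral _ _).trans
      (h.lintegral_pd_els_mul_vort_le hσ a))
  have hI2 : ‖∫ y in Iic c, els σ u b (a, y) * quadPart σ u b P (a, y)‖ₑ ≤ 128 * (μ * κ ^ 2) :=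
    (enorm_integral_le_lintegral_enorm _).trans ((setLIntegral_le_lintegral _ _).trans
      (h.lintegral_els_mul_quadPart_le hσ a))
  dsimp only
  rw [hsplit]
  set I1 := ∫ y in Iic c, pd 1 (els σ u b) (a, y) * vort u (a, y)
  set I2 := ∫ y in Iic c, els σ u b (a, y) * quadPart σ u b P (a, y)
  have hre : els σ u b (a, c) ^ 2 - σ * (2 * (els σ u b (a, c) * vort u (a, c) - I1) - 2 * I2
      + σ * els σ u b (a, c) ^ 2) = σ * (2 * (-(els σ u b (a, c) * vort u (a, c)) + (I1 + I2))) := by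
    linear_combination (-els σ u b (a, c) ^ 2) * hσ2
  rw [hre, enorm_mul, enorm_sign hσ, one_mul, enorm_mul, h2]
  calc _ ≤ 2 * (‖els σ u b (a, c) * vort u (a, c)‖ₑ + (8 * κ ^ 2 + 128 * (μ * κ ^ 2))) := by
        gcongr
        refine (enorm_add_le _ _).trans ?_
        rw [enorm_neg]
        gcongr
        exact (enorm_add_le _ _).trans (add_le_add hI1 hI2)
    _ = _ := by ring

end TimeSlice

/-- The uniform bound of the vorticity by the `H²` norm of `∇u`. -/
lemma enorm_vort_sq_le {u : Fin 2 → ℝ × ℝ → ℝ} (hu : ∀ i, ContDiff ℝ 3 (u i)) {k : ℝ≥0}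
    (h0 : ∀ i j, sqL2 (pd j (u i)) ≤ k ^ 2) (h1 : ∀ i j l, sqL2 (pd l (pd j (u i))) ≤ k ^ 2)
    (h2 : ∀ i j l m, sqL2 (pd m (pd l (pd j (u i)))) ≤ k ^ 2) (x : ℝ × ℝ) :
    ‖vort u x‖ₑ ^ 2 ≤ 16 * k ^ 2 := by
  have hc : ∀ i j, Controlled k k (pd j (u i)) := fun i j =>
    ⟨contDiff_pd (n := 2) (hu i) j, h0 i j, h1 i j, h1 i j 1, h2 i j 1⟩
  have h := enorm_add_sq_le (pd 1 (u 0) x) (-pd 0 (u 1) x)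
  rw [enorm_neg, ← sub_eq_add_neg] at h
  refine h.trans ((add_le_add (mul_le_mul' le_rfl ((hc 0 1).enorm_sq_le x))
    (mul_le_mul' le_rfl ((hc 1 0).enorm_sq_le x))).trans (le_of_eq ?_))
  ring

end MHD

namespace MHD

/-! ### Almost everywhere derivatives of primitives with a parameter -/

lemma measurable_primitive {X : Type*} [MeasurableSpace X] {D : ℝ × X → ℝ} (hD : Measurable D) :
    Measurable fun z : ℝ × X => ∫ s in 0..z.1, D (s, z.2) := by
  have h : ∀ (l r : ℝ × X → ℝ), Measurable l → Measurable r →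
      Measurable fun z : ℝ × X => ∫ s in Ioc (l z) (r z), D (s, z.2) := by
    intro l r hl hr
    have hset : MeasurableSet {p : (ℝ × X) × ℝ | p.2 ∈ Ioc (l p.1) (r p.1)} :=
      (measurableSet_lt (hl.comp measurable_fst) measurable_snd).inter
        (measurableSet_le measurable_snd (hr.comp measurable_fst))
    have hm : Measurable ({p : (ℝ × X) × ℝ | p.2 ∈ Ioc (l p.1) (r p.1)}.indicator
        fun p => D (p.2, p.1.2)) :=
      (hD.comp (by fun_prop)).indicator hset
    have := (hm.stronglyMeasurable.integral_prod_right' (ν := (volume : Measure ℝ))).measurable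
    convert this using 1
    funext z
    rw [← integral_indicator measurableSet_Ioc]
    rfl
  unfold intervalIntegral
  exact (h _ _ measurable_const measurable_fst).sub (h _ _ measurable_fst measurable_const)

/-- The Lebesgue differentiation theorem, jointly in time and a parameter. Differentiability is
tested on rational increments, so that the exceptional set is measurable and Fubini applies. -/
lemma ae_hasDerivAt_primitive {X : Type*} [MeasurableSpace X] {ν : Measure X} [SFinite ν]
    {D : ℝ × X → ℝ} (hD : Measurable D) (hint : ∀ x, Integrable fun s => D (s, x)) :
    ∀ᵐ z ∂((volume : Measure ℝ).prod ν),
      HasDerivAt (fun τ => ∫ s in 0..τ, D (s, z.2)) (D z) z.1 := by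
  set H : ℝ × X → ℝ := fun z => ∫ s in 0..z.1, D (s, z.2) with hH
  have hHm : Measurable H := measurable_primitive hD
  have hHc : ∀ x, Continuous fun τ => H (τ, x) := fun x =>
    intervalIntegral.continuous_primitive (fun a b => (hint x).intervalIntegrable) 0
  let S : Set (ℝ × X) := {z | ∀ m : ℕ, ∃ n : ℕ, ∀ q : ℚ, |(q : ℝ)| < 1 / ((n : ℝ) + 1) →
    |H (z.1 + q, z.2) - H z - q * D z| ≤ 1 / ((m : ℝ) + 1) * |(q : ℝ)|}
  have hS : MeasurableSet S := by
    have : S = ⋂ m : ℕ, ⋃ n : ℕ, ⋂ q : ℚ, {z | |(q : ℝ)| < 1 / ((n : ℝ) + 1) →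
        |H (z.1 + q, z.2) - H z - q * D z| ≤ 1 / ((m : ℝ) + 1) * |(q : ℝ)|} := by
      ext z; simp [S]
    rw [this]
    refine MeasurableSet.iInter fun m => MeasurableSet.iUnion fun n => MeasurableSet.iInter
      fun q => ?_
    by_cases hq : |(q : ℝ)| < 1 / ((n : ℝ) + 1)
    · simp only [hq, true_imp_iff]
      refine measurableSet_le ?_ measurable_const
      have h1 : Measurable fun z : ℝ × X => H (z.1 + q, z.2) := hHm.comp (by fun_prop)
      exact ((h1.sub hHm).sub (hD.const_mul _)).abs
    · simp only [hq, false_imp_iff, ofPred_true, MeasurableSet.univ]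
  have hderiv : ∀ z, HasDerivAt (fun τ => H (τ, z.2)) (D z) z.1 ↔ ∀ c : ℝ, 0 < c →
      ∀ᶠ h in nhds (0 : ℝ), |H (z.1 + h, z.2) - H z - h * D z| ≤ c * |h| := by
    intro z
    rw [hasDerivAt_iff_isLittleO_nhds_zero, Asymptotics.isLittleO_iff]
    simp only [smul_eq_mul, Real.norm_eq_abs]
  have hSderiv : ∀ z ∈ S, HasDerivAt (fun τ => H (τ, z.2)) (D z) z.1 := by
    intro z hz
    rw [hderiv]
    intro c hc
    obtain ⟨m, hm⟩ := exists_nat_one_div_lt hc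
    obtain ⟨n, hn⟩ := hz m
    have hpos : (0 : ℝ) < 1 / ((n : ℝ) + 1) := by positivity
    filter_upwards [Metric.ball_mem_nhds (0 : ℝ) hpos] with h hh
    -- the closed condition passes from rational to real increments
    have hcl : IsClosed {h : ℝ | |H (z.1 + h, z.2) - H z - h * D z| ≤
        1 / ((m : ℝ) + 1) * |h|} := by
      have hcont : Continuous fun h : ℝ => H (z.1 + h, z.2) := (hHc z.2).comp (by fun_prop)
      exact isClosed_le (((hcont.sub continuous_const).sub
        (continuous_id.mul continuous_const)).abs) (by fun_prop)
    have hmem : h ∈ closure (Metric.ball (0 : ℝ) (1 / ((n : ℝ) + 1)) ∩ range ((↑) : ℚ → ℝ)) :=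
      Rat.denseRange_cast.open_subset_closure_inter Metric.isOpen_ball hh
    have hsub : Metric.ball (0 : ℝ) (1 / ((n : ℝ) + 1)) ∩ range ((↑) : ℚ → ℝ) ⊆
        {h : ℝ | |H (z.1 + h, z.2) - H z - h * D z| ≤ 1 / ((m : ℝ) + 1) * |h|} := by
      rintro _ ⟨hq, q, rfl⟩
      exact hn q (by rwa [mem_ball_zero_iff, Real.norm_eq_abs] at hq)
    exact (closure_minimal hsub hcl hmem).trans
      (mul_le_mul_of_nonneg_right hm.le (abs_nonneg h))
  have hsec : ∀ x, volume ((fun τ : ℝ => (τ, x)) ⁻¹' Sᶜ) = 0 := by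
    intro x
    have := LocallyIntegrable.ae_hasDerivAt_integral (hint x).locallyIntegrable
    refine measure_mono_null (fun τ hτ => ?_) (ae_iff.1 this)
    intro hd
    refine hτ fun m => ?_
    have h1 := (hderiv (τ, x)).1 (hd 0) (1 / ((m : ℝ) + 1)) (by positivity)
    obtain ⟨δ, hδ, hball⟩ := Metric.eventually_nhds_iff.1 h1
    obtain ⟨n, hn⟩ := exists_nat_one_div_lt hδ
    exact ⟨n, fun q hq => hball (by rw [dist_zero_right, Real.norm_eq_abs]; exact hq.trans hn)⟩
  have hnull : (volume : Measure ℝ).prod ν Sᶜ = 0 := by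
    rw [Measure.prod_apply_symm hS.compl]
    simp only [hsec, lintegral_zero]
  rw [ae_iff]
  exact measure_mono_null (fun z hz hzS => hz (hSderiv z hzS)) hnull

end MHD

namespace MHD

/-! ### Functions on the slab `[0, T] × ℝ²` -/

/-- The function `(τ, x) ↦ F τ x` is of class `Cⁿ` on the closed slab `[0, T] × ℝ²`. -/
def SlabSmooth (n : ℕ) (T : ℝ) (F : ℝ → ℝ × ℝ → ℝ) : Prop :=
  ContDiffOn ℝ n (fun z : ℝ × (ℝ × ℝ) => F z.1 z.2) (Icc 0 T ×ˢ univ)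

/-- The time derivative on the closed slab, one-sided at the end points. -/
noncomputable def timeDeriv (T : ℝ) (F : ℝ → ℝ × ℝ → ℝ) (τ : ℝ) (x : ℝ × ℝ) : ℝ :=
  fderivWithin ℝ (fun z : ℝ × (ℝ × ℝ) => F z.1 z.2) (Icc 0 T ×ˢ univ) (τ, x) (1, 0)

lemma uniqueDiffOn_slab {T : ℝ} (hT : 0 < T) :
    UniqueDiffOn ℝ (Icc (0 : ℝ) T ×ˢ (univ : Set (ℝ × ℝ))) :=
  (uniqueDiffOn_Icc hT).prod uniqueDiffOn_univ

namespace SlabSmooth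

variable {n : ℕ} {T τ : ℝ} {F : ℝ → ℝ × ℝ → ℝ}

lemma of_le (h : SlabSmooth n T F) {m : ℕ} (hm : m ≤ n) : SlabSmooth m T F :=
  ContDiffOn.of_le h (by exact_mod_cast hm)

lemma slice (h : SlabSmooth n T F) (hτ : τ ∈ Icc 0 T) : ContDiff ℝ n (F τ) :=
  ContDiffOn.comp_contDiff (f := fun x : ℝ × ℝ => (τ, x)) h (by fun_prop) fun _ => ⟨hτ, trivial⟩

lemma pd (h : SlabSmooth (n + 1) T F) (hT : 0 < T) (j : Fin 2) :
    SlabSmooth n T fun τ => pd j (F τ) := by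
  have h1 : ContDiffOn ℝ n (fun z : ℝ × (ℝ × ℝ) =>
      fderivWithin ℝ (fun z : ℝ × (ℝ × ℝ) => F z.1 z.2) (Icc 0 T ×ˢ univ) z (0, e j))
      (Icc 0 T ×ˢ univ) :=
    (ContDiffOn.fderivWithin h (uniqueDiffOn_slab hT) (by norm_cast)).clm_apply contDiffOn_const
  refine h1.congr fun z hz => ?_
  have hd := ((ContDiffOn.differentiableOn h (by simp)) z hz).hasFDerivWithinAt
  have hc : HasFDerivAt (fun x : ℝ × ℝ => (z.1, x)) (ContinuousLinearMap.inr ℝ ℝ (ℝ × ℝ)) z.2 :=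
    hasFDerivAt_prodMk_right _ _
  have := HasFDerivWithinAt.comp_hasFDerivAt z.2 (f := fun x : ℝ × ℝ => (z.1, x)) hd hc
    (Filter.Eventually.of_forall fun x => ⟨hz.1, trivial⟩)
  change fderiv ℝ (F z.1) z.2 (e j) = _
  rw [show fderiv ℝ (F z.1) z.2 = _ from this.fderiv]
  simp

lemma timeDeriv (h : SlabSmooth (n + 1) T F) (hT : 0 < T) : SlabSmooth n T (timeDeriv T F) :=
  (ContDiffOn.fderivWithin h (uniqueDiffOn_slab hT) (by norm_cast)).clm_apply contDiffOn_const

lemma hasDerivAt (h : SlabSmooth (n + 1) T F) (hτ : τ ∈ Ioo 0 T) (x : ℝ × ℝ) :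
    HasDerivAt (fun s => F s x) (MHD.timeDeriv T F τ x) τ := by
  have hz : (τ, x) ∈ Icc 0 T ×ˢ (univ : Set (ℝ × ℝ)) := ⟨Ioo_subset_Icc_self hτ, trivial⟩
  have hd := ((ContDiffOn.differentiableOn h (by simp)) (τ, x) hz).hasFDerivWithinAt
  have hc : HasDerivAt (fun s : ℝ => (s, x)) (1, 0) τ :=
    (hasDerivAt_id τ).prodMk (hasDerivAt_const τ x)
  refine HasFDerivWithinAt.comp_hasDerivAt τ (f := fun s : ℝ => (s, x)) hd hc ?_
  filter_upwards [isOpen_Ioo.mem_nhds hτ] with s hs using ⟨Ioo_subset_Icc_self hs, trivial⟩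

lemma continuousOn_line (h : SlabSmooth n T F) (x : ℝ × ℝ) :
    ContinuousOn (fun s => F s x) (Icc 0 T) :=
  (ContDiffOn.continuousOn h).comp (f := fun s : ℝ => (s, x)) (by fun_prop)
    fun _ hs => ⟨hs, trivial⟩

/-- Spatial and time derivatives commute. -/
lemma hasDerivAt_pd (h : SlabSmooth 2 T F) (hτ : τ ∈ Ioo 0 T) (j : Fin 2) (x : ℝ × ℝ) :
    HasDerivAt (fun s => MHD.pd j (F s) x) (MHD.pd j (MHD.timeDeriv T F τ) x) τ := by
  set f : ℝ × (ℝ × ℝ) → ℝ := fun z => F z.1 z.2 with hf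
  have hnhds : ∀ s ∈ Ioo 0 T, ∀ y : ℝ × ℝ, Icc 0 T ×ˢ (univ : Set (ℝ × ℝ)) ∈ nhds (s, y) := by
    intro s hs y
    refine Filter.mem_of_superset ((isOpen_Ioo.prod isOpen_univ).mem_nhds
      (show (s, y) ∈ Ioo 0 T ×ˢ univ from ⟨hs, trivial⟩)) (prod_mono Ioo_subset_Icc_self le_rfl)
  have hcd : ∀ s ∈ Ioo 0 T, ∀ y : ℝ × ℝ, ContDiffAt ℝ 2 f (s, y) := fun s hs y =>
    (ContDiffOn.contDiffWithinAt h (mem_of_mem_nhds (hnhds s hs y))).contDiffAt (hnhds s hs y)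
  have hdd : DifferentiableAt ℝ (fderiv ℝ f) (τ, x) :=
    ((hcd τ hτ x).fderiv_right (m := 1) (by norm_num)).differentiableAt one_ne_zero
  have hpd : ∀ s ∈ Ioo 0 T, MHD.pd j (F s) x = fderiv ℝ f (s, x) (0, e j) := by
    intro s hs
    have hd := ((hcd s hs x).differentiableAt two_ne_zero).hasFDerivAt
    have hc : HasFDerivAt (fun x : ℝ × ℝ => (s, x)) (ContinuousLinearMap.inr ℝ ℝ (ℝ × ℝ)) x :=
      hasFDerivAt_prodMk_right _ _
    have := HasFDerivAt.comp x (f := fun x : ℝ × ℝ => (s, x)) hd hc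
    rw [MHD.pd, show fderiv ℝ (F s) x = _ from this.fderiv]
    simp
  have htd : MHD.timeDeriv T F τ = fun y => fderiv ℝ f (τ, y) (1, 0) := by
    funext y
    rw [MHD.timeDeriv, fderivWithin_of_mem_nhds (hnhds τ hτ y)]
  have hvec : ∀ v : ℝ × (ℝ × ℝ), HasFDerivAt (fun z => fderiv ℝ f z v)
      ((ContinuousLinearMap.apply ℝ ℝ v) ∘L fderiv ℝ (fderiv ℝ f) (τ, x)) (τ, x) := fun v =>
    (ContinuousLinearMap.apply ℝ ℝ v).hasFDerivAt.comp (τ, x) hdd.hasFDerivAt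
  have h1 : HasDerivAt (fun s => fderiv ℝ f (s, x) (0, e j))
      (fderiv ℝ (fderiv ℝ f) (τ, x) (1, 0) (0, e j)) τ := by
    have hc : HasDerivAt (fun s : ℝ => (s, x)) ((1 : ℝ), (0 : ℝ × ℝ)) τ :=
      (hasDerivAt_id τ).prodMk (hasDerivAt_const τ x)
    exact (hvec (0, e j)).comp_hasDerivAt τ hc
  have h2 : MHD.pd j (MHD.timeDeriv T F τ) x =
      fderiv ℝ (fderiv ℝ f) (τ, x) (0, e j) (1, 0) := by
    have hc : HasFDerivAt (fun x : ℝ × ℝ => (τ, x)) (ContinuousLinearMap.inr ℝ ℝ (ℝ × ℝ)) x :=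
      hasFDerivAt_prodMk_right _ _
    have := HasFDerivAt.comp x (f := fun x : ℝ × ℝ => (τ, x)) (hvec (1, 0)) hc
    rw [htd, MHD.pd]
    rw [show fderiv ℝ (fun y => fderiv ℝ f (τ, y) (1, 0)) x = _ from this.fderiv]
    simp
  rw [h2, ((hcd τ hτ x).isSymmSndFDerivAt (by simp)).eq]
  refine h1.congr_of_eventuallyEq ?_
  filter_upwards [isOpen_Ioo.mem_nhds hτ] with s hs using hpd s hs

lemma aestronglyMeasurable (h : SlabSmooth n T F) :
    AEStronglyMeasurable (fun z : ℝ × (ℝ × ℝ) => F z.1 z.2)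
      (volume.restrict (Ioo 0 T ×ˢ univ)) :=
  ((ContDiffOn.continuousOn h).mono (prod_mono Ioo_subset_Icc_self le_rfl)).aestronglyMeasurable
    (measurableSet_Ioo.prod MeasurableSet.univ)

lemma measurable_indicator (h : SlabSmooth n T F) :
    Measurable ((Ioo 0 T ×ˢ univ).indicator fun z : ℝ × (ℝ × ℝ) => F z.1 z.2) := by
  classical
  rw [← piecewise_eq_indicator]
  exact ((ContDiffOn.continuousOn h).mono (prod_mono Ioo_subset_Icc_self
    le_rfl)).measurable_piecewise continuousOn_const (measurableSet_Ioo.prod MeasurableSet.univ)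

end SlabSmooth

/-! ### Consequences of the equations -/

/-- `div (z · ∇z) = 2 ((∂₂z₂)² + ∂₁z₂ ∂₂z₁)` for a divergence-free field `z`. -/
lemma div_convection {z : Fin 2 → ℝ × ℝ → ℝ} (hz : ∀ i, ContDiff ℝ 2 (z i))
    (dz : ∀ x, ∑ j, pd j (z j) x = 0) (x : ℝ × ℝ) :
    ∑ i, pd i (fun x => ∑ j, z j x * pd j (z i) x) x =
      2 * (pd 1 (z 1) x * pd 1 (z 1) x + pd 0 (z 1) x * pd 1 (z 0) x) := by
  have d0 : ∀ i, DifferentiableAt ℝ (z i) x := fun i => (hz i).differentiable two_ne_zero x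
  have d1 : ∀ i j, DifferentiableAt ℝ (pd j (z i)) x := fun i j =>
    (contDiff_pd (n := 1) (hz i) j).differentiable one_ne_zero x
  have h1 : ∀ i, pd i (fun x => ∑ j, z j x * pd j (z i) x) x =
      (z 0 x * pd 0 (pd i (z i)) x + pd i (z 0) x * pd 0 (z i) x)
      + (z 1 x * pd 1 (pd i (z i)) x + pd i (z 1) x * pd 1 (z i) x) := by
    intro i
    simp only [Fin.sum_univ_two]
    rw [pd_add ((d0 0).fun_mul (d1 i 0)) ((d0 1).fun_mul (d1 i 1)), pd_mul (d0 0) (d1 i 0),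
      pd_mul (d0 1) (d1 i 1), pd_comm (hz i) i, pd_comm (hz i) i]
  have h2 : ∀ j, pd j (pd 0 (z 0)) x + pd j (pd 1 (z 1)) x = 0 := by
    intro j
    rw [← pd_add (d1 0 0) (d1 1 1)]
    have : (fun x => pd 0 (z 0) x + pd 1 (z 1) x) = fun _ => 0 := by
      funext x; simpa [Fin.sum_univ_two] using dz x
    rw [this]; simp [pd]
  have h3 := dz x
  rw [Fin.sum_univ_two] at h3
  rw [Fin.sum_univ_two, h1, h1]
  linear_combination z 0 x * h2 0 + z 1 x * h2 1 + (pd 0 (z 0) x - pd 1 (z 1) x) * h3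

/-- `Δu = (∂₂φ, -∂₁φ)` for a divergence-free field `u`. -/
lemma lap_eq {u : Fin 2 → ℝ × ℝ → ℝ} (hu : ∀ i, ContDiff ℝ 3 (u i))
    (du : ∀ x, ∑ j, pd j (u j) x = 0) :
    lap (u 0) = pd 1 (vort u) ∧ lap (u 1) = fun x => -pd 0 (vort u) x := by
  have hu2 : ∀ i, ContDiff ℝ 2 (u i) := fun i => (hu i).of_le (by norm_num)
  have d1 : ∀ i j x, DifferentiableAt ℝ (pd j (u i)) x := fun i j =>
    (contDiff_pd (n := 1) (hu2 i) j).differentiable one_ne_zero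
  have h2 : ∀ j x, pd j (pd 0 (u 0)) x + pd j (pd 1 (u 1)) x = 0 := by
    intro j x
    rw [← pd_add (d1 0 0 x) (d1 1 1 x)]
    have : (fun x => pd 0 (u 0) x + pd 1 (u 1) x) = fun _ => 0 := by
      funext x; simpa [Fin.sum_univ_two] using du x
    rw [this]; simp [pd]
  have hv : ∀ j x, pd j (vort u) x = pd j (pd 1 (u 0)) x - pd j (pd 0 (u 1)) x := fun j x =>
    pd_sub (d1 0 1 x) (d1 1 0 x) j
  constructor
  · funext x
    rw [hv, lap, Fin.sum_univ_two, pd_comm (hu2 1) 1 0]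
    linear_combination h2 0 x
  · funext x
    rw [hv, lap, Fin.sum_univ_two, pd_comm (hu2 0) 0 1]
    linear_combination h2 1 x

namespace IsSolution

variable {T : ℝ} {u b : Fin 2 → ℝ → ℝ × ℝ → ℝ} {P : ℝ → ℝ × ℝ → ℝ}

lemma slab_u (h : IsSolution T u b P) (i : Fin 2) : SlabSmooth 3 T (u i) := h.smooth_u i

lemma slab_b (h : IsSolution T u b P) (i : Fin 2) : SlabSmooth 2 T (b i) := h.smooth_b i

lemma slab_P (h : IsSolution T u b P) : SlabSmooth 1 T P := h.smooth_P

/-- The momentum equation, solved for the pressure gradient. -/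
lemma pd_P_eq (h : IsSolution T u b P) {τ : ℝ} (hτ : τ ∈ Ioo 0 T) (i : Fin 2) :
    pd i (P τ) = fun x => ((∑ j, b j τ x * pd j (b i τ) x) - (∑ j, u j τ x * pd j (u i τ) x))
      + ((lap (u i τ) x - timeDeriv T (u i) τ x) + pd 1 (b i τ) x) := by
  funext x
  have h1 := h.momentum τ hτ x i
  rw [((h.slab_u i).hasDerivAt hτ x).deriv] at h1
  linear_combination h1

lemma contDiff_lap (h : IsSolution T u b P) {τ : ℝ} (hτ : τ ∈ Icc 0 T) (i : Fin 2) :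
    ContDiff ℝ 1 (lap (u i τ)) :=
  ContDiff.sum fun j _ => contDiff_pd (n := 1)
    (contDiff_pd (n := 2) ((h.slab_u i).slice hτ) j) j

lemma contDiff_convection {z : Fin 2 → ℝ × ℝ → ℝ} (hz : ∀ i, ContDiff ℝ 2 (z i)) (i : Fin 2) :
    ContDiff ℝ 1 fun x => ∑ j, z j x * pd j (z i) x :=
  ContDiff.sum fun j _ => ((hz j).of_le (by norm_num)).mul (contDiff_pd (n := 1) (hz i) j)

lemma contDiff_pd_P (h : IsSolution T u b P) (hT : 0 < T) {τ : ℝ} (hτ : τ ∈ Ioo 0 T) (i : Fin 2) :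
    ContDiff ℝ 1 (pd i (P τ)) := by
  have hτ' := Ioo_subset_Icc_self hτ
  have hu : ∀ i, ContDiff ℝ 2 (u i τ) := fun i => ((h.slab_u i).slice hτ').of_le (by norm_num)
  have hb : ∀ i, ContDiff ℝ 2 (b i τ) := fun i => (h.slab_b i).slice hτ'
  rw [h.pd_P_eq hτ i]
  exact ((contDiff_convection hb i).sub (contDiff_convection hu i)).add
    (((h.contDiff_lap hτ' i).sub ((((h.slab_u i).timeDeriv hT).slice hτ').of_le
      (by norm_num))).add (contDiff_pd (n := 1) (hb i) 1))

/-- The pressure equation, the divergence of the momentum equation. -/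
lemma lap_P (h : IsSolution T u b P) (hT : 0 < T) {τ : ℝ} (hτ : τ ∈ Ioo 0 T) (x : ℝ × ℝ) :
    lap (P τ) x =
      2 * (pd 1 (b 1 τ) x * pd 1 (b 1 τ) x + pd 0 (b 1 τ) x * pd 1 (b 0 τ) x)
      - 2 * (pd 1 (u 1 τ) x * pd 1 (u 1 τ) x + pd 0 (u 1 τ) x * pd 1 (u 0 τ) x) := by
  have hτ' := Ioo_subset_Icc_self hτ
  have hu3 : ∀ i, ContDiff ℝ 3 (u i τ) := fun i => (h.slab_u i).slice hτ'
  have hu : ∀ i, ContDiff ℝ 2 (u i τ) := fun i => (hu3 i).of_le (by norm_num)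
  have hb : ∀ i, ContDiff ℝ 2 (b i τ) := fun i => (h.slab_b i).slice hτ'
  have e1 := fun i => (contDiff_convection (z := fun i => b i τ) hb i).differentiable one_ne_zero x
  have e2 := fun i => (contDiff_convection (z := fun i => u i τ) hu i).differentiable one_ne_zero x
  have e3 := fun i => (h.contDiff_lap hτ' i).differentiable one_ne_zero x
  have e4 := fun i => (((h.slab_u i).timeDeriv hT).slice hτ').differentiable (by simp) x
  have e5 := fun i => (contDiff_pd (n := 1) (hb i) 1).differentiable one_ne_zero x
  have hsplit : ∀ i, pd i (pd i (P τ)) x =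
      (pd i (fun x => ∑ j, b j τ x * pd j (b i τ) x) x
        - pd i (fun x => ∑ j, u j τ x * pd j (u i τ) x) x)
      + ((pd i (lap (u i τ)) x - pd i (timeDeriv T (u i) τ) x) + pd i (pd 1 (b i τ)) x) := by
    intro i
    rw [← pd_sub (e1 i) (e2 i), ← pd_sub (e3 i) (e4 i), ← pd_add ((e3 i).fun_sub (e4 i)) (e5 i),
      ← pd_add ((e1 i).fun_sub (e2 i)) (((e3 i).fun_sub (e4 i)).fun_add (e5 i)), h.pd_P_eq hτ i]
  have hconvb := div_convection hb (h.div_b τ hτ') x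
  have hconvu := div_convection hu (h.div_u τ hτ') x
  have hlap : pd 0 (lap (u 0 τ)) x + pd 1 (lap (u 1 τ)) x = 0 := by
    obtain ⟨l0, l1⟩ := lap_eq hu3 (h.div_u τ hτ')
    have hv : ContDiff ℝ 2 (vort fun i => u i τ) :=
      (contDiff_pd (n := 2) (hu3 0) 1).sub (contDiff_pd (n := 2) (hu3 1) 0)
    rw [l0, l1, pd_neg, pd_comm hv 1 0, add_neg_cancel]
  have htime : pd 0 (timeDeriv T (u 0) τ) x + pd 1 (timeDeriv T (u 1) τ) x = 0 := by
    have h1 := (((h.slab_u 0).of_le (m := 2) (by norm_num)).hasDerivAt_pd hτ 0 x).add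
      (((h.slab_u 1).of_le (m := 2) (by norm_num)).hasDerivAt_pd hτ 1 x)
    refine h1.unique ((hasDerivAt_const τ (0 : ℝ)).congr_of_eventuallyEq ?_)
    filter_upwards [isOpen_Ioo.mem_nhds hτ] with s hs
    simpa [Fin.sum_univ_two] using h.div_u s (Ioo_subset_Icc_self hs) x
  have hdb : pd 0 (pd 1 (b 0 τ)) x + pd 1 (pd 1 (b 1 τ)) x = 0 := by
    rw [pd_comm (hb 0) 0 1, ← pd_add ((contDiff_pd (n := 1) (hb 0) 0).differentiable one_ne_zero x)
      ((contDiff_pd (n := 1) (hb 1) 1).differentiable one_ne_zero x)]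
    have : (fun x => pd 0 (b 0 τ) x + pd 1 (b 1 τ) x) = fun _ => 0 := by
      funext x; simpa [Fin.sum_univ_two] using h.div_b τ hτ' x
    rw [this]; simp [pd]
  rw [lap, Fin.sum_univ_two, hsplit, hsplit]
  rw [Fin.sum_univ_two] at hconvb hconvu
  linear_combination hconvb - hconvu + hlap - htime + hdb

/-- The equation of the Elsässer variable. -/
lemma hasDerivAt_Om (h : IsSolution T u b P) {σ : ℝ} (hσ : σ = 1 ∨ σ = -1) {τ : ℝ}
    (hτ : τ ∈ Ioo 0 T) (x : ℝ × ℝ) :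
    HasDerivAt (fun s => Om σ u b s x)
      (elsRhs σ (fun i => u i τ) (fun i => b i τ) (P τ) x) τ := by
  have hτ' := Ioo_subset_Icc_self hτ
  have hu3 : ∀ i, ContDiff ℝ 3 (u i τ) := fun i => (h.slab_u i).slice hτ'
  have hb : ∀ i, ContDiff ℝ 2 (b i τ) := fun i => (h.slab_b i).slice hτ'
  have hdu := (h.slab_u 0).hasDerivAt hτ x
  have hdb := (h.slab_b 0).hasDerivAt hτ x
  have h1 := h.momentum τ hτ x 0
  have h2 := h.induction τ hτ x 0
  rw [hdu.deriv] at h1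
  rw [hdb.deriv] at h2
  have hpd : ∀ j, pd j (els σ (fun i => u i τ) fun i => b i τ) x =
      pd j (u 0 τ) x + σ * pd j (b 0 τ) x := by
    intro j
    have g1 := (hu3 0).differentiable three_ne_zero x
    have g2 := (hb 0).differentiable two_ne_zero x
    rw [← pd_const_mul g2]
    exact pd_add g1 (g2.const_mul σ) j
  refine (hdu.add (hdb.const_mul σ)).congr_deriv ?_
  have hσ2 : σ * σ = 1 := by rcases hσ with rfl | rfl <;> norm_num
  rw [(lap_eq hu3 (h.div_u τ hτ')).1] at h1
  simp only [elsRhs, quadPart, hpd, Fin.sum_univ_two] at *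
  linear_combination h1 + σ * h2 + (b 0 τ x * pd 0 (b 0 τ) x + b 1 τ x * pd 1 (b 0 τ) x
    + pd 1 (b 0 τ) x) * (-hσ2)

end IsSolution

end MHD

namespace MHD

/-! ### Energy bounds along a solution -/

lemma sqL2_le_sqH2 (f : ℝ × ℝ → ℝ) : sqL2 f ≤ sqH2 f := by
  rw [sqH2, add_assoc]; exact le_self_add

lemma sqL2_pd_le_sqH2 (f : ℝ × ℝ → ℝ) (i : Fin 2) : sqL2 (pd i f) ≤ sqH2 f := by
  rw [sqH2]
  exact (Finset.single_le_sum (f := fun i => sqL2 (pd i f)) (fun _ _ => zero_le)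
    (Finset.mem_univ i)).trans (le_add_self.trans le_self_add)

lemma sqL2_pd_pd_le_sqH2 (f : ℝ × ℝ → ℝ) (i j : Fin 2) : sqL2 (pd i (pd j f)) ≤ sqH2 f := by
  rw [sqH2]
  exact (Finset.single_le_sum (f := fun j => sqL2 (pd i (pd j f))) (fun _ _ => zero_le)
    (Finset.mem_univ j)).trans ((Finset.single_le_sum (f := fun i => ∑ j, sqL2 (pd i (pd j f)))
      (fun _ _ => zero_le) (Finset.mem_univ i)).trans le_add_self)

/-- The squared `H²` norm of `∇u` at time `τ`. -/
noncomputable def gradEnergy (u : Fin 2 → ℝ → ℝ × ℝ → ℝ) (τ : ℝ) : ℝ≥0∞ :=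
  ∑ i, ∑ j, sqH2 (pd j (u i τ))

/-- The squared `H¹` norm of `∂₂b` at time `τ`. -/
noncomputable def vertEnergy (b : Fin 2 → ℝ → ℝ × ℝ → ℝ) (τ : ℝ) : ℝ≥0∞ :=
  ∑ i, sqH1 (pd 1 (b i τ))

lemma sqH2_le_gradEnergy (u : Fin 2 → ℝ → ℝ × ℝ → ℝ) (τ : ℝ) (i j : Fin 2) :
    sqH2 (pd j (u i τ)) ≤ gradEnergy u τ :=
  (Finset.single_le_sum (f := fun j => sqH2 (pd j (u i τ))) (fun _ _ => zero_le)
    (Finset.mem_univ j)).trans (Finset.single_le_sum (f := fun i => ∑ j, sqH2 (pd j (u i τ)))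
      (fun _ _ => zero_le) (Finset.mem_univ i))

lemma sqH1_le_vertEnergy (b : Fin 2 → ℝ → ℝ × ℝ → ℝ) (τ : ℝ) (i : Fin 2) :
    sqH1 (pd 1 (b i τ)) ≤ vertEnergy b τ :=
  Finset.single_le_sum (f := fun i => sqH1 (pd 1 (b i τ))) (fun _ _ => zero_le)
    (Finset.mem_univ i)

lemma coe_le_one_add_sq (κ : ℝ≥0) : (κ : ℝ≥0∞) ≤ 1 + κ ^ 2 := by
  norm_cast
  rcases le_total κ 1 with hk | hk
  · exact hk.trans le_self_add
  · exact (le_self_pow₀ hk two_ne_zero).trans le_add_self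

lemma lintegral_gradEnergy_le (u b : Fin 2 → ℝ → ℝ × ℝ → ℝ) (T : ℝ) :
    ∫⁻ τ in Ioo 0 T, gradEnergy u τ ≤ E₀ u b T := le_add_self

lemma sqH2_le_E₀ (u b : Fin 2 → ℝ → ℝ × ℝ → ℝ) {T τ : ℝ} (hτ : τ ∈ Icc 0 T) (i : Fin 2) :
    sqH2 (u i τ) ≤ E₀ u b T ∧ sqH2 (b i τ) ≤ E₀ u b T := by
  have h : (∑ i, sqH2 (u i τ)) + ∑ i, sqH2 (b i τ) ≤ E₀ u b T :=
    (le_iSup₂ (f := fun τ (_ : τ ∈ Icc 0 T) => (∑ i, sqH2 (u i τ)) + ∑ i, sqH2 (b i τ))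
      τ hτ).trans le_self_add
  exact ⟨(Finset.single_le_sum (f := fun i => sqH2 (u i τ)) (fun _ _ => zero_le)
      (Finset.mem_univ i)).trans (le_self_add.trans h),
    (Finset.single_le_sum (f := fun i => sqH2 (b i τ)) (fun _ _ => zero_le)
      (Finset.mem_univ i)).trans (le_add_self.trans h)⟩

lemma SlabSmooth.aemeasurable_sqL2 {n : ℕ} {T : ℝ} {F : ℝ → ℝ × ℝ → ℝ} (h : SlabSmooth n T F) :
    AEMeasurable (fun τ => sqL2 (F τ)) (volume.restrict (Ioo 0 T)) := by
  have hm := h.measurable_indicator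
  refine ⟨fun τ => ∫⁻ x, ‖(Ioo 0 T ×ˢ univ).indicator
    (fun z : ℝ × (ℝ × ℝ) => F z.1 z.2) (τ, x)‖ₑ ^ 2,
    Measurable.lintegral_prod_right' (f := fun z => ‖(Ioo 0 T ×ˢ univ).indicator
      (fun z : ℝ × (ℝ × ℝ) => F z.1 z.2) z‖ₑ ^ 2) (by fun_prop), ?_⟩
  filter_upwards [ae_restrict_mem measurableSet_Ioo] with τ hτ
  rw [sqL2_eq]
  congr 1; funext x
  rw [indicator_of_mem (show (τ, x) ∈ Ioo 0 T ×ˢ univ from ⟨hτ, trivial⟩)]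

lemma slab_measure_eq (T : ℝ) : volume.restrict (Ioo 0 T ×ˢ (univ : Set (ℝ × ℝ))) =
    (volume.restrict (Ioo (0 : ℝ) T)).prod (volume : Measure (ℝ × ℝ)) := by
  rw [Measure.volume_eq_prod ℝ (ℝ × ℝ), ← Measure.prod_restrict, Measure.restrict_univ]

namespace IsSolution

variable {T : ℝ} {u b : Fin 2 → ℝ → ℝ × ℝ → ℝ} {P : ℝ → ℝ × ℝ → ℝ} {σ : ℝ}

/-- The restriction of a solution to a shorter time interval. -/
lemma mono (h : IsSolution T u b P) {t : ℝ} (ht : t ∈ Icc 0 T) : IsSolution t u b P := by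
  have hI : Icc 0 t ⊆ Icc 0 T := Icc_subset_Icc_right ht.2
  have hO : Ioo 0 t ⊆ Ioo 0 T := Ioo_subset_Ioo_right ht.2
  have hS : Icc 0 t ×ˢ (univ : Set (ℝ × ℝ)) ⊆ Icc 0 T ×ˢ univ := prod_mono hI le_rfl
  exact
    { smooth_u := fun i => (h.smooth_u i).mono hS
      smooth_b := fun i => (h.smooth_b i).mono hS
      smooth_P := h.smooth_P.mono hS
      momentum := fun τ hτ => h.momentum τ (hO hτ)
      induction := fun τ hτ => h.induction τ (hO hτ)
      div_u := fun τ hτ => h.div_u τ (hI hτ)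
      div_b := fun τ hτ => h.div_b τ (hI hτ)
      finite_energy := lt_of_le_of_lt (add_le_add
        (biSup_mono fun τ hτ => hI hτ) (lintegral_mono_set hO)) h.finite_energy
      pressure := fun τ hτ => h.pressure τ (hI hτ) }

lemma exists_sq_eq (h : IsSolution T u b P) : ∃ μ : ℝ≥0, E₀ u b T = (μ : ℝ≥0∞) ^ 2 := by
  refine ⟨NNReal.sqrt (E₀ u b T).toNNReal, ?_⟩
  rw [← ENNReal.coe_pow, NNReal.sq_sqrt, ENNReal.coe_toNNReal h.finite_energy.ne]

lemma timeSlice (h : IsSolution T u b P) (hT : 0 < T) {τ : ℝ} (hτ : τ ∈ Ioo 0 T) {μ κ : ℝ≥0}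
    (hμ : E₀ u b T ≤ (μ : ℝ≥0∞) ^ 2) (hκ : gradEnergy u τ + vertEnergy b τ ≤ (κ : ℝ≥0∞) ^ 2) :
    TimeSlice μ κ (fun i => u i τ) (fun i => b i τ) (P τ) := by
  have hτ' := Ioo_subset_Icc_self hτ
  have hgu : ∀ i j, sqH2 (pd j (u i τ)) ≤ (κ : ℝ≥0∞) ^ 2 := fun i j =>
    (sqH2_le_gradEnergy u τ i j).trans (le_self_add.trans hκ)
  have hgb : ∀ i, sqH1 (pd 1 (b i τ)) ≤ (κ : ℝ≥0∞) ^ 2 := fun i =>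
    (sqH1_le_vertEnergy b τ i).trans (le_add_self.trans hκ)
  have hmu := fun i => (sqH2_le_E₀ u b hτ' i).1.trans hμ
  have hmb := fun i => (sqH2_le_E₀ u b hτ' i).2.trans hμ
  exact
    { smooth_u := fun i => (h.slab_u i).slice hτ'
      ctrl_u := fun i =>
        { smooth := ((h.slab_u i).slice hτ').of_le (by norm_num)
          bound := (sqL2_le_sqH2 _).trans (hmu i)
          bound_pd := fun j => (sqL2_pd_le_sqH2 _ j).trans (hmu i)
          gain := (sqL2_le_sqH2 _).trans (hgu i 1)
          gain_pd := fun j => (sqL2_pd_le_sqH2 _ j).trans (hgu i 1) }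
      ctrl_b := fun i =>
        { smooth := (h.slab_b i).slice hτ'
          bound := (sqL2_le_sqH2 _).trans (hmb i)
          bound_pd := fun j => (sqL2_pd_le_sqH2 _ j).trans (hmb i)
          gain := le_self_add.trans (hgb i)
          gain_pd := fun j => (Finset.single_le_sum (f := fun j => sqL2 (pd j (pd 1 (b i τ))))
            (fun _ _ => zero_le) (Finset.mem_univ j)).trans (le_add_self.trans (hgb i)) }
      gain_u := fun i j => (sqL2_le_sqH2 _).trans (hgu i j)
      gain_u' := fun i j k => (sqL2_pd_le_sqH2 _ k).trans (hgu i j)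
      gain_u'' := fun i j k l => (sqL2_pd_pd_le_sqH2 _ l k).trans (hgu i j)
      div_u := h.div_u τ hτ'
      div_b := h.div_b τ hτ'
      smooth_P := h.slab_P.slice hτ'
      smooth_pd_P := h.contDiff_pd_P hT hτ
      sqL2_pd_P := h.pressure τ hτ'
      lap_P := h.lap_P hT hτ }

lemma slab_Om (h : IsSolution T u b P) (σ : ℝ) : SlabSmooth 2 T (Om σ u b) :=
  (ContDiffOn.of_le (h.smooth_u 0) (by norm_num)).add (contDiffOn_const.mul (h.smooth_b 0))

lemma slab_d11b2 (h : IsSolution T u b P) (hT : 0 < T) : SlabSmooth 0 T (d11b2 b) :=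
  SlabSmooth.pd (n := 0) (SlabSmooth.pd (n := 1) (h.slab_b 1) hT 0) hT 0

lemma slab_vort (h : IsSolution T u b P) (hT : 0 < T) :
    SlabSmooth 2 T fun τ => vort fun i => u i τ :=
  ContDiffOn.sub (SlabSmooth.pd (n := 2) (h.slab_u 0) hT 1)
    (SlabSmooth.pd (n := 2) (h.slab_u 1) hT 0)

lemma lineSq_Om_le (h : IsSolution T u b P) (hσ : σ = 1 ∨ σ = -1) {τ : ℝ} (hτ : τ ∈ Icc 0 T)
    {μ : ℝ≥0} (hμ : E₀ u b T ≤ (μ : ℝ≥0∞) ^ 2) (a : ℝ) :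
    lineSq (Om σ u b τ) a ≤ 8 * μ ^ 2 := by
  have hu : ContDiff ℝ 1 (u 0 τ) := ((h.slab_u 0).slice hτ).of_le (by norm_num)
  have hb : ContDiff ℝ 1 (b 0 τ) := ((h.slab_b 0).slice hτ).of_le (by norm_num)
  obtain ⟨hmu, hmb⟩ := sqH2_le_E₀ u b hτ 0
  have h1 := lineSq_le hu ((sqL2_le_sqH2 _).trans (hmu.trans hμ))
    ((sqL2_pd_le_sqH2 _ 0).trans (hmu.trans hμ)) a
  have h2 := lineSq_le hb ((sqL2_le_sqH2 _).trans (hmb.trans hμ))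
    ((sqL2_pd_le_sqH2 _ 0).trans (hmb.trans hμ)) a
  refine (lineSq_add_le hu.continuous (TimeSlice.enorm_sign hσ) a).trans ?_
  refine (add_le_add (mul_le_mul' le_rfl h1) (mul_le_mul' le_rfl h2)).trans (le_of_eq ?_)
  ring

lemma integrable_Om_sq (h : IsSolution T u b P) (hσ : σ = 1 ∨ σ = -1) {τ : ℝ}
    (hτ : τ ∈ Icc 0 T) (a : ℝ) : Integrable fun y => Om σ u b τ (a, y) ^ 2 := by
  obtain ⟨μ, hμ⟩ := h.exists_sq_eq
  have hc : Continuous (Om σ u b τ) := ((h.slab_Om σ).slice hτ).continuous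
  refine ⟨(by fun_prop : Continuous fun y : ℝ => Om σ u b τ (a, y) ^ 2).aestronglyMeasurable, ?_⟩
  rw [hasFiniteIntegral_iff_enorm]
  simp only [enorm_pow]
  exact (h.lineSq_Om_le hσ hτ hμ.le a).trans_lt (by finiteness)

lemma aemeasurable_gradEnergy (h : IsSolution T u b P) (hT : 0 < T) :
    AEMeasurable (gradEnergy u) (volume.restrict (Ioo 0 T)) := by
  have h1 := fun i j => SlabSmooth.pd (n := 2) (h.slab_u i) hT j
  have h2 := fun i j k => SlabSmooth.pd (n := 1) (h1 i j) hT k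
  have h3 := fun i j k l => SlabSmooth.pd (n := 0) (h2 i j k) hT l
  refine Finset.aemeasurable_fun_sum _ fun i _ => Finset.aemeasurable_fun_sum _ fun j _ => ?_
  exact ((h1 i j).aemeasurable_sqL2.add (Finset.aemeasurable_fun_sum _ fun k _ =>
    (h2 i j k).aemeasurable_sqL2)).add (Finset.aemeasurable_fun_sum _ fun l _ =>
      Finset.aemeasurable_fun_sum _ fun k _ => (h3 i j k l).aemeasurable_sqL2)

lemma aemeasurable_vertEnergy (h : IsSolution T u b P) (hT : 0 < T) :
    AEMeasurable (vertEnergy b) (volume.restrict (Ioo 0 T)) := by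
  have h1 := fun i => SlabSmooth.pd (n := 1) (h.slab_b i) hT 1
  have h2 := fun i k => SlabSmooth.pd (n := 0) (h1 i) hT k
  exact Finset.aemeasurable_fun_sum _ fun i _ => (h1 i).aemeasurable_sqL2.add
    (Finset.aemeasurable_fun_sum _ fun k _ => (h2 i k).aemeasurable_sqL2)

lemma lintegral_energy_le (h : IsSolution T u b P) (hT : 0 < T) :
    ∫⁻ τ in Ioo 0 T, (gradEnergy u τ + vertEnergy b τ) ≤ E₀ u b T + E₁ b T := by
  rw [lintegral_add_left' (h.aemeasurable_gradEnergy hT)]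
  exact add_le_add (lintegral_gradEnergy_le u b T) le_rfl

lemma E₁_lt_top (h : IsSolution T u b P) : E₁ b T < ∞ := by
  have hfin := h.finite_energy
  have hle : ∀ τ ∈ Ioo 0 T, ∑ i, sqH1 (pd 1 (b i τ)) ≤ 6 * E₀ u b T := by
    intro τ hτ
    have h1 : ∀ i, sqH1 (pd 1 (b i τ)) ≤ 3 * E₀ u b T := by
      intro i
      have hb := (sqH2_le_E₀ u b (Ioo_subset_Icc_self hτ) i).2
      rw [sqH1, Fin.sum_univ_two]
      refine (add_le_add ((sqL2_pd_le_sqH2 _ 1).trans hb) (add_le_add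
        ((sqL2_pd_pd_le_sqH2 _ 0 1).trans hb)
        ((sqL2_pd_pd_le_sqH2 _ 1 1).trans hb))).trans (le_of_eq (by ring))
    rw [Fin.sum_univ_two]
    exact (add_le_add (h1 0) (h1 1)).trans (le_of_eq (by ring))
  refine (setLIntegral_mono' measurableSet_Ioo hle).trans_lt ?_
  rw [setLIntegral_const, Real.volume_Ioo]
  exact ENNReal.mul_lt_top (ENNReal.mul_lt_top (by simp) hfin) ENNReal.ofReal_lt_top

/-- At almost every time the solution provides a `TimeSlice`. -/
lemma ae_exists_timeSlice (h : IsSolution T u b P) (hT : 0 < T) {μ : ℝ≥0}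
    (hμ : E₀ u b T ≤ (μ : ℝ≥0∞) ^ 2) :
    ∀ᵐ τ ∂(volume.restrict (Ioo 0 T)), ∃ κ : ℝ≥0,
      gradEnergy u τ + vertEnergy b τ = (κ : ℝ≥0∞) ^ 2 ∧
      TimeSlice μ κ (fun i => u i τ) (fun i => b i τ) (P τ) := by
  have hfin : ∫⁻ τ in Ioo 0 T, (gradEnergy u τ + vertEnergy b τ) ≠ ∞ :=
    ((h.lintegral_energy_le hT).trans_lt
      (ENNReal.add_lt_top.2 ⟨h.finite_energy, h.E₁_lt_top⟩)).ne
  filter_upwards [ae_lt_top' ((h.aemeasurable_gradEnergy hT).add (h.aemeasurable_vertEnergy hT))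
    hfin, ae_restrict_mem measurableSet_Ioo] with τ hlt hmem
  have hτ : gradEnergy u τ + vertEnergy b τ < ∞ := hlt
  have hκ : gradEnergy u τ + vertEnergy b τ =
      ((NNReal.sqrt (gradEnergy u τ + vertEnergy b τ).toNNReal : ℝ≥0) : ℝ≥0∞) ^ 2 := by
    rw [← ENNReal.coe_pow, NNReal.sq_sqrt, ENNReal.coe_toNNReal hτ.ne]
  exact ⟨_, hκ, h.timeSlice hT hmem hμ hκ.le⟩

/-! ### The time derivative of the primitive of `Ω²` -/

lemma timeDeriv_Om_eq (h : IsSolution T u b P) (hσ : σ = 1 ∨ σ = -1) {τ : ℝ} (hτ : τ ∈ Ioo 0 T)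
    (x : ℝ × ℝ) : timeDeriv T (Om σ u b) τ x =
      elsRhs σ (fun i => u i τ) (fun i => b i τ) (P τ) x :=
  ((h.slab_Om σ).hasDerivAt (n := 1) hτ x).unique (h.hasDerivAt_Om hσ hτ x)

end IsSolution

/-- The density `∂ₜ(Ω²) = 2 Ω ∂ₜΩ` on the open slab, extended by zero. -/
noncomputable def sqRate (σ T : ℝ) (u b : Fin 2 → ℝ → ℝ × ℝ → ℝ) : ℝ × (ℝ × ℝ) → ℝ :=
  (Ioo 0 T ×ˢ univ).indicator fun z => 2 * (Om σ u b z.1 z.2 * timeDeriv T (Om σ u b) z.1 z.2)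

/-- The function `∫_{-∞}^{x₂} ∂ₜ(Ω²) dy`, extended by zero outside the open slab. -/
noncomputable def primRate (σ T : ℝ) (u b : Fin 2 → ℝ → ℝ × ℝ → ℝ) (z : ℝ × (ℝ × ℝ)) : ℝ :=
  ∫ y in Iic z.2.2, sqRate σ T u b (z.1, (z.2.1, y))

namespace IsSolution

variable {T : ℝ} {u b : Fin 2 → ℝ → ℝ × ℝ → ℝ} {P : ℝ → ℝ × ℝ → ℝ} {σ : ℝ}

lemma measurable_sqRate (h : IsSolution T u b P) (hT : 0 < T) :
    Measurable (sqRate σ T u b) := by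
  have h1 : SlabSmooth 1 T (timeDeriv T (Om σ u b)) := (h.slab_Om σ).timeDeriv (n := 1) hT
  have h2 : SlabSmooth 1 T fun τ x => 2 * (Om σ u b τ x * timeDeriv T (Om σ u b) τ x) :=
    contDiffOn_const.mul (ContDiffOn.mul ((h.slab_Om σ).of_le (m := 1) (by norm_num)) h1)
  exact h2.measurable_indicator

lemma measurable_primRate (h : IsSolution T u b P) (hT : 0 < T) :
    Measurable (primRate σ T u b) := by
  have hset : MeasurableSet {p : (ℝ × (ℝ × ℝ)) × ℝ | p.2 ≤ p.1.2.2} :=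
    measurableSet_le measurable_snd (by fun_prop)
  have hm : Measurable ({p : (ℝ × (ℝ × ℝ)) × ℝ | p.2 ≤ p.1.2.2}.indicator
      fun p => sqRate σ T u b (p.1.1, (p.1.2.1, p.2))) :=
    ((h.measurable_sqRate hT).comp (by fun_prop)).indicator hset
  have := (hm.stronglyMeasurable.integral_prod_right' (ν := (volume : Measure ℝ))).measurable
  convert this using 1
  funext z
  rw [primRate, ← integral_indicator measurableSet_Iic]
  rfl

/-- The density is integrable over `(0, T) × {x₁ = a}`. -/
lemma lintegral_sqRate_lt_top (h : IsSolution T u b P) (hT : 0 < T) (hσ : σ = 1 ∨ σ = -1)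
    (a : ℝ) : ∫⁻ τ, ∫⁻ y, ‖sqRate σ T u b (τ, (a, y))‖ₑ < ∞ := by
  obtain ⟨μ, hμ⟩ := h.exists_sq_eq
  have hout : ∀ τ ∉ Ioo 0 T, ∫⁻ y, ‖sqRate σ T u b (τ, (a, y))‖ₑ = 0 := by
    intro τ hτ
    have : ∀ y : ℝ, (τ, (a, y)) ∉ Ioo 0 T ×ˢ (univ : Set (ℝ × ℝ)) := fun y hy => hτ hy.1
    simp [sqRate, this]
  rw [← setLIntegral_eq_of_support_subset (s := Ioo 0 T)
    (fun τ hτ => by_contra fun hn => hτ (hout τ hn))]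
  have hbound : ∀ᵐ τ ∂(volume.restrict (Ioo 0 T)),
      ∫⁻ y, ‖sqRate σ T u b (τ, (a, y))‖ₑ ≤
        32 * μ + 288 * μ * (gradEnergy u τ + vertEnergy b τ) := by
    filter_upwards [h.ae_exists_timeSlice hT hμ.le, ae_restrict_mem measurableSet_Ioo]
      with τ ⟨κ, hκ, hs⟩ hτ
    have hin : ∀ y : ℝ, (τ, (a, y)) ∈ Ioo 0 T ×ˢ (univ : Set (ℝ × ℝ)) := fun y => ⟨hτ, trivial⟩
    have heq : ∀ y, ‖sqRate σ T u b (τ, (a, y))‖ₑ =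
        2 * ‖els σ (fun i => u i τ) (fun i => b i τ) (a, y) *
          elsRhs σ (fun i => u i τ) (fun i => b i τ) (P τ) (a, y)‖ₑ := by
      intro y
      rw [sqRate, indicator_of_mem (hin y), enorm_mul]
      dsimp only
      rw [h.timeDeriv_Om_eq hσ hτ]
      congr 1
      simp [Real.enorm_eq_ofReal]
    simp only [heq]
    rw [lintegral_const_mul' _ _ (by simp), hκ]
    refine (mul_le_mul' le_rfl (hs.lintegral_els_mul_elsRhs_le hσ a)).trans ?_
    have hκ1 := coe_le_one_add_sq κ
    calc (2 : ℝ≥0∞) * (16 * (μ * κ) + 128 * (μ * κ ^ 2))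
        ≤ 2 * (16 * (μ * (1 + κ ^ 2)) + 128 * (μ * κ ^ 2)) := by gcongr
      _ = _ := by ring
  refine (lintegral_mono_ae hbound).trans_lt ?_
  rw [lintegral_add_left measurable_const, setLIntegral_const,
    lintegral_const_mul' _ _ (by finiteness)]
  refine ENNReal.add_lt_top.2 ⟨?_, ENNReal.mul_lt_top (by finiteness) ?_⟩
  · rw [Real.volume_Ioo]; finiteness
  · exact (h.lintegral_energy_le hT).trans_lt
      (ENNReal.add_lt_top.2 ⟨h.finite_energy, h.E₁_lt_top⟩)

lemma integrable_primRate (h : IsSolution T u b P) (hT : 0 < T) (hσ : σ = 1 ∨ σ = -1)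
    (x : ℝ × ℝ) : Integrable fun τ => primRate σ T u b (τ, x) := by
  refine ⟨((h.measurable_primRate hT).comp (by fun_prop)).aestronglyMeasurable, ?_⟩
  rw [hasFiniteIntegral_iff_enorm]
  refine lt_of_le_of_lt (lintegral_mono fun τ => ?_) (h.lintegral_sqRate_lt_top hT hσ x.1)
  exact (enorm_integral_le_lintegral_enorm _).trans (setLIntegral_le_lintegral _ _)

/-- The primitive of `Ω²` is absolutely continuous in time. -/
lemma prim_eq (h : IsSolution T u b P) (hT : 0 < T) (hσ : σ = 1 ∨ σ = -1) {τ : ℝ}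
    (hτ : τ ∈ Ioo 0 T) (x : ℝ × ℝ) :
    prim σ u b τ x = prim σ u b 0 x + ∫ s in 0..τ, primRate σ T u b (s, x) := by
  obtain ⟨a, c⟩ := x
  have h0 : (0 : ℝ) ∈ Icc 0 T := ⟨le_rfl, hT.le⟩
  have hftc : ∀ y, Om σ u b τ (a, y) ^ 2 - Om σ u b 0 (a, y) ^ 2 =
      ∫ s in Ioc 0 τ, sqRate σ T u b (s, (a, y)) := by
    intro y
    have hsub : Icc 0 τ ⊆ Icc 0 T := Icc_subset_Icc_right hτ.2.le
    have hc : ContinuousOn (fun s => Om σ u b s (a, y)) (Icc 0 τ) :=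
      ((h.slab_Om σ).continuousOn_line (a, y)).mono hsub
    have hc' : ContinuousOn (fun s => timeDeriv T (Om σ u b) s (a, y)) (Icc 0 τ) :=
      (((h.slab_Om σ).timeDeriv (n := 1) hT).continuousOn_line (a, y)).mono hsub
    have h1 := intervalIntegral.integral_eq_sub_of_hasDerivAt_of_le hτ.1.le
      (f := fun s => Om σ u b s (a, y) ^ 2) (hc.pow 2)
      (f' := fun s => 2 * (Om σ u b s (a, y) * timeDeriv T (Om σ u b) s (a, y)))
      (fun s hs => by
        have := ((h.slab_Om σ).hasDerivAt (n := 1) ⟨hs.1, hs.2.trans hτ.2⟩ (a, y)).fun_pow 2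
        simpa [mul_assoc] using this)
      ((continuousOn_const.mul (hc.mul hc')).intervalIntegrable_of_Icc hτ.1.le)
    rw [intervalIntegral.integral_of_le hτ.1.le] at h1
    refine h1.symm.trans (setIntegral_congr_fun measurableSet_Ioc fun s hs => ?_)
    rw [sqRate, indicator_of_mem]
    exact ⟨⟨hs.1, hs.2.trans_lt hτ.2⟩, trivial⟩
  have hint : Integrable (Function.uncurry fun y s => sqRate σ T u b (s, (a, y)))
      ((volume.restrict (Iic c)).prod (volume.restrict (Ioc 0 τ))) := by
    have hm : Measurable (Function.uncurry fun y s => sqRate σ T u b (s, (a, y))) :=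
      (h.measurable_sqRate hT).comp (by fun_prop)
    refine ⟨hm.aestronglyMeasurable, ?_⟩
    rw [hasFiniteIntegral_iff_enorm, lintegral_prod_symm _ hm.enorm.aemeasurable]
    refine lt_of_le_of_lt ?_ (h.lintegral_sqRate_lt_top hT hσ a)
    refine (setLIntegral_le_lintegral _ _).trans (lintegral_mono fun s => ?_)
    exact setLIntegral_le_lintegral _ _
  have hswap := integral_integral_swap hint
  rw [← sub_eq_iff_eq_add', prim, prim, ← integral_sub
    (h.integrable_Om_sq hσ (Ioo_subset_Icc_self hτ) a).integrableOn
    (h.integrable_Om_sq hσ h0 a).integrableOn, intervalIntegral.integral_of_le hτ.1.le]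
  simp only [hftc]
  exact hswap

lemma hasDerivAt_prim (h : IsSolution T u b P) (hT : 0 < T) (hσ : σ = 1 ∨ σ = -1) {τ : ℝ}
    (hτ : τ ∈ Ioo 0 T) {x : ℝ × ℝ}
    (hd : HasDerivAt (fun τ => ∫ s in 0..τ, primRate σ T u b (s, x)) (primRate σ T u b (τ, x)) τ) :
    HasDerivAt (fun s => prim σ u b s x) (primRate σ T u b (τ, x)) τ := by
  refine (hd.const_add (prim σ u b 0 x)).congr_of_eventuallyEq ?_
  filter_upwards [isOpen_Ioo.mem_nhds hτ] with s hs using h.prim_eq hT hσ hs x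

lemma ae_differentiableAt_prim (h : IsSolution T u b P) (hT : 0 < T) (hσ : σ = 1 ∨ σ = -1)
    (x : ℝ × ℝ) : ∀ᵐ τ ∂(volume.restrict (Ioo 0 T)),
      DifferentiableAt ℝ (fun s => prim σ u b s x) τ := by
  have h1 := ae_restrict_of_ae (s := Ioo 0 T) (LocallyIntegrable.ae_hasDerivAt_integral
    (h.integrable_primRate hT hσ x).locallyIntegrable)
  filter_upwards [h1, ae_restrict_mem measurableSet_Ioo] with τ hd hτ
  exact (h.hasDerivAt_prim hT hσ hτ (hd 0)).differentiableAt

lemma ae_G_eq (h : IsSolution T u b P) (hT : 0 < T) (hσ : σ = 1 ∨ σ = -1) :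
    ∀ᵐ z ∂(volume.restrict (Ioo 0 T ×ˢ (univ : Set (ℝ × ℝ)))),
      G σ u b z.1 z.2 = Om σ u b z.1 z.2 ^ 2 - σ * primRate σ T u b z := by
  have h1 := ae_restrict_of_ae (s := Ioo 0 T ×ˢ (univ : Set (ℝ × ℝ)))
    (ae_hasDerivAt_primitive (ν := (volume : Measure (ℝ × ℝ))) (h.measurable_primRate (σ := σ) hT)
      (h.integrable_primRate hT hσ))
  filter_upwards [h1, ae_restrict_mem (measurableSet_Ioo.prod MeasurableSet.univ)] with z hd hz
  rw [G, (h.hasDerivAt_prim hT hσ hz.1 hd).deriv]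

end IsSolution

end MHD

namespace MHD

/-! ### The weighted estimate -/

namespace IsSolution

variable {T : ℝ} {u b : Fin 2 → ℝ → ℝ × ℝ → ℝ} {P : ℝ → ℝ × ℝ → ℝ} {σ : ℝ}

lemma sqL2_d11b2_le (u b : Fin 2 → ℝ → ℝ × ℝ → ℝ) {τ : ℝ} (hτ : τ ∈ Icc 0 T) :
    sqL2 (d11b2 b τ) ≤ E₀ u b T :=
  (sqL2_pd_pd_le_sqH2 (b 1 τ) 0 0).trans (sqH2_le_E₀ u b hτ 1).2

lemma enorm_vort_sq_le (h : IsSolution T u b P) {τ : ℝ} (hτ : τ ∈ Icc 0 T) (x : ℝ × ℝ) :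
    ‖vort (fun i => u i τ) x‖ₑ ^ 2 ≤ 16 * gradEnergy u τ := by
  rcases eq_or_ne (gradEnergy u τ) ∞ with htop | hfin
  · simp [htop]
  have hk : gradEnergy u τ = ((NNReal.sqrt (gradEnergy u τ).toNNReal : ℝ≥0) : ℝ≥0∞) ^ 2 := by
    rw [← ENNReal.coe_pow, NNReal.sq_sqrt, ENNReal.coe_toNNReal hfin]
  have hg := fun i j => (sqH2_le_gradEnergy u τ i j).trans hk.le
  have := MHD.enorm_vort_sq_le (u := fun i => u i τ) (fun i => (h.slab_u i).slice hτ)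
    (fun i j => (sqL2_le_sqH2 _).trans (hg i j))
    (fun i j k => (sqL2_pd_le_sqH2 _ k).trans (hg i j))
    (fun i j k l => (sqL2_pd_pd_le_sqH2 _ l k).trans (hg i j)) x
  rwa [← hk] at this

/-- The boundary term of the integration by parts, which is the source of `A`. -/
lemma lintegral_boundary_le (h : IsSolution T u b P) (hT : 0 < T) {μ : ℝ≥0}
    (hμ : E₀ u b T = (μ : ℝ≥0∞) ^ 2) :
    ∫⁻ τ in Ioo 0 T, ∫⁻ x, ‖(Om σ u b τ x * d11b2 b τ x) *
      (vort (fun i => u i τ) x * d11b2 b τ x)‖ₑ ≤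
      4 * (μ : ℝ≥0∞) ^ 2 * A σ u b T ^ (1 / 2 : ℝ) := by
  have hO := (h.slab_Om σ).of_le (m := 0) (by norm_num)
  have hw := h.slab_d11b2 hT
  have hv := (h.slab_vort hT).of_le (m := 0) (by norm_num)
  have hOw : SlabSmooth 0 T fun τ x => Om σ u b τ x * d11b2 b τ x := ContDiffOn.mul hO hw
  have hvw : SlabSmooth 0 T fun τ x => vort (fun i => u i τ) x * d11b2 b τ x :=
    ContDiffOn.mul hv hw
  have m1 := hOw.aestronglyMeasurable.aemeasurable
  have m2 := hvw.aestronglyMeasurable.aemeasurable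
  rw [slab_measure_eq] at m1 m2
  have hcs := sq_lintegral_mul_le m1 m2
  rw [lintegral_prod _ (m1.fun_mul m2).enorm, lintegral_prod _ (m1.enorm.pow_const 2),
    lintegral_prod _ (m2.enorm.pow_const 2)] at hcs
  have hA : ∫⁻ τ in Ioo 0 T, ∫⁻ x, ‖Om σ u b τ x * d11b2 b τ x‖ₑ ^ 2 = A σ u b T := by
    simp only [A, ← mul_pow, ofReal_sq_eq_enorm]
  have hV : ∫⁻ τ in Ioo 0 T, ∫⁻ x, ‖vort (fun i => u i τ) x * d11b2 b τ x‖ₑ ^ 2 ≤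
      (4 * (μ : ℝ≥0∞) ^ 2) ^ 2 := by
    calc _ ≤ ∫⁻ τ in Ioo 0 T, 16 * (μ : ℝ≥0∞) ^ 2 * gradEnergy u τ := by
          refine setLIntegral_mono' measurableSet_Ioo fun τ hτ => ?_
          have hτ' := Ioo_subset_Icc_self hτ
          have hwm := ((h.slab_d11b2 hT).slice hτ').continuous.measurable
          calc _ ≤ ∫⁻ x, 16 * gradEnergy u τ * ‖d11b2 b τ x‖ₑ ^ 2 := by
                refine lintegral_mono fun x => ?_
                rw [enorm_mul, mul_pow]
                gcongr
                exact h.enorm_vort_sq_le hτ' x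
            _ = 16 * gradEnergy u τ * sqL2 (d11b2 b τ) := by
                rw [lintegral_const_mul _ (by fun_prop), sqL2_eq]
            _ ≤ 16 * gradEnergy u τ * (μ : ℝ≥0∞) ^ 2 := by
                gcongr
                exact (sqL2_d11b2_le u b hτ').trans hμ.le
            _ = _ := by ring
      _ ≤ 16 * (μ : ℝ≥0∞) ^ 2 * (μ : ℝ≥0∞) ^ 2 := by
          rw [lintegral_const_mul' _ _ (by finiteness)]
          gcongr
          exact (lintegral_gradEnergy_le u b T).trans hμ.le
      _ = _ := by ring
  have hcs' := hcs.trans (mul_le_mul' hA.le hV)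
  rw [← ENNReal.pow_le_pow_left_iff two_ne_zero, mul_pow, ← ENNReal.rpow_natCast (A σ u b T ^ _),
    ← ENNReal.rpow_mul]
  refine hcs'.trans (le_of_eq ?_)
  norm_num
  ring

/-- The `L¹` bound of the weighted function `G`. -/
lemma lintegral_G_le (h : IsSolution T u b P) (hT : 0 < T) (hσ : σ = 1 ∨ σ = -1) :
    ∫⁻ τ in Ioo 0 T, ∫⁻ x, ‖G σ u b τ x * d11b2 b τ x ^ 2‖ₑ ≤
      256 * (E₀ u b T + E₀ u b T ^ (3 / 2 : ℝ)) * (E₀ u b T + E₁ b T)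
        + 256 * E₀ u b T * A σ u b T ^ (1 / 2 : ℝ) := by
  obtain ⟨μ, hμ⟩ := h.exists_sq_eq
  have hG := h.ae_G_eq hT hσ
  rw [slab_measure_eq] at hG
  have hae : ∀ᵐ τ ∂(volume.restrict (Ioo 0 T)),
      ∫⁻ x, ‖G σ u b τ x * d11b2 b τ x ^ 2‖ₑ ≤
        2 * (∫⁻ x, ‖(Om σ u b τ x * d11b2 b τ x) * (vort (fun i => u i τ) x * d11b2 b τ x)‖ₑ)
        + (16 + 256 * μ) * μ ^ 2 * (gradEnergy u τ + vertEnergy b τ) := by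
    filter_upwards [Measure.ae_ae_of_ae_prod hG, h.ae_exists_timeSlice hT hμ.le,
      ae_restrict_mem measurableSet_Ioo] with τ hGτ ⟨κ, hκ, hs⟩ hτ
    have hτ' := Ioo_subset_Icc_self hτ
    have hwc : Continuous (d11b2 b τ) := ((h.slab_d11b2 hT).slice hτ').continuous
    have hOc : Continuous (Om σ u b τ) := ((h.slab_Om σ).slice hτ').continuous
    have hvc : Continuous (vort fun i => u i τ) := ((h.slab_vort hT).slice hτ').continuous
    have hwm := hwc.measurable
    have hOm := hOc.measurable
    have hvm := hvc.measurable
    have hrate : ∀ x : ℝ × ℝ, primRate σ T u b (τ, x) = ∫ y in Iic x.2,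
        2 * (els σ (fun i => u i τ) (fun i => b i τ) (x.1, y) *
          elsRhs σ (fun i => u i τ) (fun i => b i τ) (P τ) (x.1, y)) := by
      intro x
      refine setIntegral_congr_fun measurableSet_Iic fun y _ => ?_
      simp only [sqRate]
      rw [indicator_of_mem (show (τ, (x.1, y)) ∈ Ioo 0 T ×ˢ univ from ⟨hτ, trivial⟩)]
      dsimp only
      rw [h.timeDeriv_Om_eq hσ hτ]
      rfl
    calc ∫⁻ x, ‖G σ u b τ x * d11b2 b τ x ^ 2‖ₑ
        ≤ ∫⁻ x, (2 * ‖(Om σ u b τ x * d11b2 b τ x) *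
            (vort (fun i => u i τ) x * d11b2 b τ x)‖ₑ
            + (16 + 256 * μ) * κ ^ 2 * ‖d11b2 b τ x‖ₑ ^ 2) := by
          refine lintegral_mono_ae (hGτ.mono fun x hx => ?_)
          rw [hx, hrate, enorm_mul, enorm_pow]
          refine (mul_le_mul' (hs.enorm_sq_sub_integral_le hσ x) le_rfl).trans (le_of_eq ?_)
          rw [show els σ (fun i => u i τ) (fun i => b i τ) x = Om σ u b τ x from rfl]
          simp only [enorm_mul]
          ring
      _ = 2 * (∫⁻ x, ‖(Om σ u b τ x * d11b2 b τ x) *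
            (vort (fun i => u i τ) x * d11b2 b τ x)‖ₑ)
            + (16 + 256 * μ) * κ ^ 2 * sqL2 (d11b2 b τ) := by
          rw [lintegral_add_left (by fun_prop), lintegral_const_mul _ (by fun_prop),
            lintegral_const_mul _ (by fun_prop), sqL2_eq]
      _ ≤ _ := by
          rw [hκ]
          refine add_le_add le_rfl ?_
          calc _ ≤ (16 + 256 * (μ : ℝ≥0∞)) * κ ^ 2 * μ ^ 2 := by
                gcongr
                exact (sqL2_d11b2_le u b hτ').trans hμ.le
            _ = _ := by ring
  have hmeas : AEMeasurable (fun τ => 2 * ∫⁻ x, ‖(Om σ u b τ x * d11b2 b τ x) *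
      (vort (fun i => u i τ) x * d11b2 b τ x)‖ₑ) (volume.restrict (Ioo 0 T)) := by
    have hS : SlabSmooth 0 T fun τ x => (Om σ u b τ x * d11b2 b τ x) *
        (vort (fun i => u i τ) x * d11b2 b τ x) :=
      ContDiffOn.mul (ContDiffOn.mul ((h.slab_Om σ).of_le (m := 0) (by norm_num))
        (h.slab_d11b2 hT)) (ContDiffOn.mul ((h.slab_vort hT).of_le (m := 0) (by norm_num))
        (h.slab_d11b2 hT))
    have m1 := hS.aestronglyMeasurable.aemeasurable
    rw [slab_measure_eq] at m1
    exact m1.enorm.lintegral_prod_right'.const_mul 2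
  have hpow : E₀ u b T ^ (3 / 2 : ℝ) = (μ : ℝ≥0∞) ^ 3 := by
    rw [hμ, ← ENNReal.rpow_natCast, ← ENNReal.rpow_mul, ← ENNReal.rpow_natCast]
    norm_num
  refine (lintegral_mono_ae hae).trans ?_
  rw [lintegral_add_left' hmeas, lintegral_const_mul' _ _ (by simp),
    lintegral_const_mul' _ _ (by finiteness), hpow]
  refine (add_le_add (mul_le_mul' le_rfl (h.lintegral_boundary_le hT hμ))
    (mul_le_mul' le_rfl (h.lintegral_energy_le hT))).trans ?_
  rw [hμ, add_comm]
  refine add_le_add ?_ ?_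
  · calc (16 + 256 * (μ : ℝ≥0∞)) * μ ^ 2 * (μ ^ 2 + E₁ b T)
        ≤ (256 + 256 * (μ : ℝ≥0∞)) * μ ^ 2 * (μ ^ 2 + E₁ b T) := by gcongr; norm_num
      _ = _ := by ring
  · calc 2 * (4 * (μ : ℝ≥0∞) ^ 2 * A σ u b T ^ (1 / 2 : ℝ))
        = 8 * (μ : ℝ≥0∞) ^ 2 * A σ u b T ^ (1 / 2 : ℝ) := by ring
      _ ≤ _ := by gcongr; norm_num

lemma A_lt_top (h : IsSolution T u b P) (hT : 0 < T) (hσ : σ = 1 ∨ σ = -1) : A σ u b T < ∞ := by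
  obtain ⟨μ, hμ⟩ := h.exists_sq_eq
  have hle : ∀ᵐ τ ∂(volume.restrict (Ioo 0 T)),
      ∫⁻ x, ENNReal.ofReal (Om σ u b τ x ^ 2 * d11b2 b τ x ^ 2) ≤
        16 * μ ^ 3 * (1 + (gradEnergy u τ + vertEnergy b τ)) := by
    filter_upwards [h.ae_exists_timeSlice hT hμ.le, ae_restrict_mem measurableSet_Ioo]
      with τ ⟨κ, hκ, hs⟩ hτ
    have hwm := ((h.slab_d11b2 hT).slice (Ioo_subset_Icc_self hτ)).continuous.measurable
    have hκ1 := coe_le_one_add_sq κ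
    calc _ ≤ ∫⁻ x, 16 * (μ * κ) * ‖d11b2 b τ x‖ₑ ^ 2 := by
          refine lintegral_mono fun x => ?_
          rw [← mul_pow, ofReal_sq_eq_enorm, enorm_mul, mul_pow]
          gcongr
          refine (enorm_add_sq_le _ _).trans ?_
          rw [enorm_mul, TimeSlice.enorm_sign hσ, one_mul]
          refine (add_le_add (mul_le_mul' le_rfl ((hs.ctrl_u 0).enorm_sq_le x))
            (mul_le_mul' le_rfl ((hs.ctrl_b 0).enorm_sq_le x))).trans (le_of_eq (by ring))
      _ = 16 * (μ * κ) * sqL2 (d11b2 b τ) := by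
          rw [lintegral_const_mul _ (by fun_prop), sqL2_eq]
      _ ≤ 16 * (μ * (1 + κ ^ 2)) * μ ^ 2 := by
          gcongr
          exact (sqL2_d11b2_le u b (Ioo_subset_Icc_self hτ)).trans hμ.le
      _ = _ := by rw [hκ]; ring
  refine (lintegral_mono_ae hle).trans_lt ?_
  rw [lintegral_const_mul' _ _ (by finiteness), lintegral_add_left measurable_const,
    setLIntegral_const, Real.volume_Ioo]
  refine ENNReal.mul_lt_top (by finiteness) (ENNReal.add_lt_top.2 ⟨by finiteness, ?_⟩)
  exact (h.lintegral_energy_le hT).trans_lt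
    (ENNReal.add_lt_top.2 ⟨h.finite_energy, h.E₁_lt_top⟩)

lemma integrableOn_G (h : IsSolution T u b P) (hT : 0 < T) (hσ : σ = 1 ∨ σ = -1) :
    IntegrableOn (fun z : ℝ × (ℝ × ℝ) => G σ u b z.1 z.2 * d11b2 b z.1 z.2 ^ 2)
      (Ioo 0 T ×ˢ univ) := by
  have hw := (h.slab_d11b2 hT).aestronglyMeasurable
  have hO := (h.slab_Om σ).aestronglyMeasurable
  have hmeas : AEStronglyMeasurable
      (fun z : ℝ × (ℝ × ℝ) => G σ u b z.1 z.2 * d11b2 b z.1 z.2 ^ 2)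
      (volume.restrict (Ioo 0 T ×ˢ univ)) := by
    refine AEStronglyMeasurable.mul (AEStronglyMeasurable.congr ((hO.pow 2).sub
      ((h.measurable_primRate (σ := σ) hT).aestronglyMeasurable.const_mul σ)) ?_) (hw.pow 2)
    exact (h.ae_G_eq hT hσ).mono fun z hz => hz.symm
  refine ⟨hmeas, ?_⟩
  rw [slab_measure_eq] at *
  rw [hasFiniteIntegral_iff_enorm, lintegral_prod _ hmeas.aemeasurable.enorm]
  refine (h.lintegral_G_le hT hσ).trans_lt ?_
  have h0 := h.finite_energy
  have h1 := h.E₁_lt_top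
  have h2 := h.A_lt_top hT hσ
  have h3 : E₀ u b T ^ (3 / 2 : ℝ) < ∞ := ENNReal.rpow_lt_top_of_nonneg (by norm_num) h0.ne
  have h4 : A σ u b T ^ (1 / 2 : ℝ) < ∞ := ENNReal.rpow_lt_top_of_nonneg (by norm_num) h2.ne
  exact ENNReal.add_lt_top.2 ⟨ENNReal.mul_lt_top (ENNReal.mul_lt_top (by simp)
    (ENNReal.add_lt_top.2 ⟨h0, h3⟩)) (ENNReal.add_lt_top.2 ⟨h0, h1⟩),
    ENNReal.mul_lt_top (ENNReal.mul_lt_top (by simp) h0) h4⟩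

end IsSolution

end MHD

theorem proposition2p1 :
    ∃ C : ℝ≥0, ∀ (T : ℝ) (u b : Fin 2 → ℝ → ℝ × ℝ → ℝ) (P : ℝ → ℝ × ℝ → ℝ),
      0 < T → MHD.IsSolution T u b P →
      ∀ t ∈ Set.Icc 0 T, ∀ σ : ℝ, (σ = 1 ∨ σ = -1) →
        -- the quantities on the left-hand side are well defined
        (∀ τ ∈ Set.Icc 0 t, ∀ x : ℝ × ℝ,
          IntegrableOn (fun y => MHD.Om σ u b τ (x.1, y) ^ 2) (Set.Iic x.2)) ∧
        (∀ x : ℝ × ℝ, ∀ᵐ τ ∂(volume.restrict (Set.Ioo 0 t)),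
          DifferentiableAt ℝ (fun s => MHD.prim σ u b s x) τ) ∧
        IntegrableOn (fun z : ℝ × (ℝ × ℝ) => MHD.G σ u b z.1 z.2 * MHD.d11b2 b z.1 z.2 ^ 2)
          (Set.Ioo 0 t ×ˢ Set.univ) ∧
        -- the estimate
        ENNReal.ofReal (∫ τ in Set.Ioo 0 t, ∫ x, MHD.G σ u b τ x * MHD.d11b2 b τ x ^ 2) ≤
          C * (MHD.E₀ u b t + MHD.E₀ u b t ^ (3 / 2 : ℝ)) * (MHD.E₀ u b t + MHD.E₁ b t)
            + C * MHD.E₀ u b t ^ (1 / 2 : ℝ) * MHD.A σ u b t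
            + C * MHD.E₀ u b t * MHD.A σ u b t ^ (1 / 2 : ℝ) := by
  refine ⟨256, fun T u b P hT h t ht σ hσ => ⟨fun τ hτ x =>
    (h.integrable_Om_sq hσ ⟨hτ.1, hτ.2.trans ht.2⟩ x.1).integrableOn, ?_⟩⟩
  rcases ht.1.eq_or_lt with rfl | ht0
  · simp
  have h' := h.mono ht
  refine ⟨h'.ae_differentiableAt_prim ht0 hσ, h'.integrableOn_G ht0 hσ, ?_⟩
  calc _ ≤ ‖∫ τ in Set.Ioo 0 t, ∫ x, MHD.G σ u b τ x * MHD.d11b2 b τ x ^ 2‖ₑ := by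
        rw [Real.enorm_eq_ofReal_abs]
        exact ENNReal.ofReal_le_ofReal (le_abs_self _)
    _ ≤ ∫⁻ τ in Set.Ioo 0 t, ∫⁻ x, ‖MHD.G σ u b τ x * MHD.d11b2 b τ x ^ 2‖ₑ :=
        (enorm_integral_le_lintegral_enorm _).trans
          (lintegral_mono fun τ => enorm_integral_le_lintegral_enorm _)
    _ ≤ _ := h'.lintegral_G_le ht0 hσ
    _ ≤ _ := by
        push_cast
        gcongr
        exact le_self_add
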